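/- **Setting.** Polynomials over $\{-1,1\}^d$ are the functions $p(x)=\sum_{I\subseteq[d]}c_p(I)\prod_{i\in I}x_i$ with $c_p(I)\in\mathbb R$; $\deg p\le k$ means $c_p(I)=0$ whenever $|I|>k$, and $\|p\|_{\mathrm{coef}}=\sum_I|c_p(I)|$. In sets of examples, equal points count as separate instances. *Contamination.* $S_{\mathrm{cln}}$ consists of $N$ i.i.d. uniform points of $\{-1,1\}^d$. An adversary removes any $\lfloor\eta N\rfloor$ of them and substitutes them with a set $S_{\mathrm{adv}}$ of $\lfloor\eta N\rfloor$ arbitrary points of $\{-1,1\}^d$; the result is the $\eta$-contaminated uniform sample $S_{\mathrm{inp}}$. *Filtering algorithm*, with inputs $S_{\mathrm{inp}}$, $\varepsilon$, $k$ and a reference set $S_{\mathrm{ref}}$ of $N$ further i.i.d. uniform points of $\{-1,1\}^d$, independent of $S_{\mathrm{cln}}$. Let $B=3^kd^{k/2}$, $\Delta=\varepsilon/(2B)$ and $S^{(0)}=S_{\mathrm{inp}}$. For $i=0,1,\dots,N$: let $p^*$ be an optimal solution (any one) of the linear program that maximizes $\sum_{x\in S^{(i)}}p(x)$ over polynomials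 $p$ with $\deg p\le k$, $\|p\|_{\mathrm{coef}}\le B$, $p\ge0$ on $S_{\mathrm{ref}}\cup S_{\mathrm{inp}}$ and $\frac1N\sum_{x\in S_{\mathrm{ref}}}p(x)\le\varepsilon/4$. If $\frac1N\sum_{x\in S^{(i)}}p^*(x)\le\varepsilon$, output $S_{\mathrm{filt}}=S^{(i)}$ and stop. Otherwise let $\tau^*\ge0$ be the smallest value with $\frac{|S^{(i)}|}{N}\Pr_{x\sim S^{(i)}}[p^*(x)>\tau^*]\ge2\Pr_{x\sim S_{\mathrm{ref}}}[p^*(x)>\tau^*]+\Delta$, and set $S^{(i+1)}=S^{(i)}\setminus\{x\in S^{(i)}:p^*(x)>\tau^*\}$. **Lemma (Outlier removal).** There is an absolute constant $C\ge1$ such that the following holds for all $d,k,N\in\mathbb N$ and all $\varepsilon,\delta,\eta\in(0,1)$ with $$N\ \ge\ C\,\frac{(3d)^{2k}}{\varepsilon^2}\,\max\{1,\log(1/\delta)\}.$$ Whatever the input and reference samples and whichever optimal solutions are used, the filtering algorithm is well defined and stops with an output $S_{\mathrm{filt}}$ within its $N+1$ iterations. Moreover: 1. With probability at least $1-\delta$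 over $S_{\mathrm{cln}}$ and $S_{\mathrm{ref}}$, for every choice of the adversary and of the optimal solutions, the filter removes no more clean than adversarial examples: $|(S_{\mathrm{inp}}\cap S_{\mathrm{cln}})\setminus S_{\mathrm{filt}}|\le|S_{\mathrm{adv}}\setminus S_{\mathrm{filt}}|$. 2. With probability at least $1-\delta$ over $S_{\mathrm{cln}}$ and $S_{\mathrm{ref}}$, for every choice of the adversary and of the optimal solutions, every polynomial $p$ that is non-negative on $\{-1,1\}^d$, has degree at most $k$ and satisfies $\mathbb E_{x\sim\mathrm{Unif}(\{-1,1\}^d)}[p(x)]\le\varepsilon/8$ also satisfies $\sum_{x\in S_{\mathrm{filt}}}p(x)\le\varepsilon N$. -/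

import Mathlib

namespace OutlierRemoval

/-- The hypercube `{-1, 1}^d`. -/
abbrev Cube (d : ℕ) : Type := Fin d → ℤˣ

/-- A polynomial over the cube, given by its coefficients: `c` stands for `∑ I, c I * x^I`, where
`I` ranges over the subsets of the coordinates and `x^I = ∏ i ∈ I, x i`. -/
abbrev CubePoly (d : ℕ) : Type := Finset (Fin d) → ℝ

/-- The value of the polynomial at a point of the cube. -/
noncomputable def evalAt {d : ℕ} (p : CubePoly d) (x : Cube d) : ℝ :=
  ∑ I : Finset (Fin d), p I * ∏ i ∈ I, (((x i : ℤˣ) : ℤ) : ℝ)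

/-- The degree of the polynomial is at most `k`. -/
def DegLE {d : ℕ} (k : ℕ) (p : CubePoly d) : Prop :=
  ∀ I : Finset (Fin d), k < I.card → p I = 0

/-- The `ℓ₁` norm of the coefficients. -/
noncomputable def coefNorm {d : ℕ} (p : CubePoly d) : ℝ :=
  ∑ I : Finset (Fin d), |p I|

/-- The expectation of the polynomial under the uniform distribution over the cube. -/
noncomputable def unifMean {d : ℕ} (p : CubePoly d) : ℝ :=
  (∑ x : Cube d, evalAt p x) / (Fintype.card (Cube d) : ℝ)

/-- A sample of `N` points of the cube. The indices make equal points separate instances; sets of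
examples are sets of indices. -/
abbrev Sample (N d : ℕ) : Type := Fin N → Cube d

/-- `inp` arises from the clean sample `cln` when an adversary removes the `⌊η N⌋` examples with
index in `R` and substitutes them with arbitrary points. So the clean examples that survive in the
input are those with index in `Rᶜ`, and the adversarial ones are those with index in `R`. -/
def IsContamination {N d : ℕ} (η : ℝ) (cln : Sample N d) (R : Finset (Fin N))
    (inp : Sample N d) : Prop :=
  R.card = ⌊η * (N : ℝ)⌋₊ ∧ ∀ i, i ∉ R → inp i = cln i

/-- The probability of an event under the uniform distribution over a finite type. -/
noncomputable def unifProb {Ω : Type} [Fintype Ω] (E : Ω → Prop) : ℝ :=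
  (Nat.card {ω : Ω // E ω} : ℝ) / (Fintype.card Ω : ℝ)

open Classical in
/-- The probability that `p x > τ` for a uniformly random example `x` of `smp` with index in `S`. -/
noncomputable def tailProb {N d : ℕ} (smp : Sample N d) (S : Finset (Fin N)) (p : CubePoly d)
    (τ : ℝ) : ℝ :=
  ((S.filter fun i => τ < evalAt p (smp i)).card : ℝ) / (S.card : ℝ)

/-- The coefficient bound `B = 3^k d^{k/2}` of the algorithm. -/
noncomputable def coefBound (d k : ℕ) : ℝ := 3 ^ k * (d : ℝ) ^ ((k : ℝ) / 2)

/-- The slack `Δ = ε / (2 B)` of the algorithm. -/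
noncomputable def slack (d k : ℕ) (ε : ℝ) : ℝ := ε / (2 * coefBound d k)

/-- The constraints of the linear program, for the reference sample `ref` and the input `inp`. -/
def IsFeasible {N d : ℕ} (k : ℕ) (ε : ℝ) (ref inp : Sample N d) (p : CubePoly d) : Prop :=
  DegLE k p ∧ coefNorm p ≤ coefBound d k ∧
    (∀ i, 0 ≤ evalAt p (ref i)) ∧ (∀ i, 0 ≤ evalAt p (inp i)) ∧
    1 / (N : ℝ) * ∑ i, evalAt p (ref i) ≤ ε / 4

/-- `p` is an optimal solution of the linear program with objective `∑ x ∈ S, p x`. -/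
def IsSolution {N d : ℕ} (k : ℕ) (ε : ℝ) (ref inp : Sample N d) (S : Finset (Fin N))
    (p : CubePoly d) : Prop :=
  IsFeasible k ε ref inp p ∧
    ∀ q, IsFeasible k ε ref inp q → ∑ i ∈ S, evalAt q (inp i) ≤ ∑ i ∈ S, evalAt p (inp i)

/-- The quantity `(1 / N) ∑ x ∈ S, p x`, which the algorithm compares with `ε`. -/
noncomputable def score {N d : ℕ} (inp : Sample N d) (S : Finset (Fin N)) (p : CubePoly d) : ℝ :=
  1 / (N : ℝ) * ∑ i ∈ S, evalAt p (inp i)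

/-- `τ` is the smallest `τ ≥ 0` with
`(|S| / N) Pr_{x ∼ S}[p x > τ] ≥ 2 Pr_{x ∼ ref}[p x > τ] + Δ`. -/
def IsThreshold {N d : ℕ} (k : ℕ) (ε : ℝ) (ref inp : Sample N d) (S : Finset (Fin N))
    (p : CubePoly d) (τ : ℝ) : Prop :=
  IsLeast {t : ℝ | 0 ≤ t ∧
    2 * tailProb ref Finset.univ p t + slack d k ε
      ≤ (S.card : ℝ) / (N : ℝ) * tailProb inp S p t} τ

open Classical in
/-- `Reaches k ε ref inp i S`: iteration `i` of the filtering algorithm can start with the set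
`S`, under some choice among the optimal solutions of the linear programs before it. -/
inductive Reaches {N d : ℕ} (k : ℕ) (ε : ℝ) (ref inp : Sample N d) :
    ℕ → Finset (Fin N) → Prop
  | start : Reaches k ε ref inp 0 Finset.univ
  | step {i : ℕ} {S : Finset (Fin N)} {p : CubePoly d} {τ : ℝ} :
      Reaches k ε ref inp i S → IsSolution k ε ref inp S p → ε < score inp S p →
      IsThreshold k ε ref inp S p τ →
      Reaches k ε ref inp (i + 1) (S \ S.filter fun j => τ < evalAt p (inp j))

/-- `T` is an output of the filtering algorithm, whose loop runs over `i = 0, 1, …, N`. -/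
def IsOutput {N d : ℕ} (k : ℕ) (ε : ℝ) (ref inp : Sample N d) (T : Finset (Fin N)) : Prop :=
  ∃ i ≤ N, Reaches k ε ref inp i T ∧ ∃ p, IsSolution k ε ref inp T p ∧ score inp T p ≤ ε

/-- Every run of the filtering algorithm produces an output, whichever optimal solutions it uses:
each linear program has an optimal solution, and an iteration that does not terminate finds its
threshold and is not the last iteration of the loop. -/
def AlwaysOutputs {N d : ℕ} (k : ℕ) (ε : ℝ) (ref inp : Sample N d) : Prop :=
  ∀ i S, Reaches k ε ref inp i S →
    (∃ p, IsSolution k ε ref inp S p) ∧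
    ∀ p, IsSolution k ε ref inp S p → ε < score inp S p →
      i < N ∧ ∃ τ, IsThreshold k ε ref inp S p τ

end OutlierRemoval

/-!
A filtering step removes the tail `{p* > τ*}` of the current set, and by the choice of `τ*` this
tail has more than twice as many examples as the same tail of the reference sample. The tails
`{p > τ}` of polynomials of degree at most `k` have VC dimension at most the dimension of the space
of these polynomials, so with high probability their frequencies in the clean and in the reference
sample differ by at most `Δ / 2`. Hence at most half of the examples removed in each step are clean.
The uniform deviation is bounded without a logarithmic loss by symmetrization, chaining over nets of
the traces of the tails, and Dudley's packing bound.

When the loop stops, the optimal value of the linear program is at most `ε`, so the second claim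
holds once every non-negative `p` of small mean is feasible. Hypercontractivity bounds its variance,
and thereby its coefficients, by its mean, and the sample means of the monomials concentrate on the
reference sample.

A threshold exists because, by the layer cake formula, integrating the reverse tail inequality over
`[0, B]` would contradict that the score of `p*` exceeds `ε`.
-/

namespace OutlierRemoval

open Finset
open scoped BigOperators symmDiff

section UniformProbability

variable {Ω Ω' : Type} [Fintype Ω] [Fintype Ω'] {E F : Ω → Prop} {c δ : ℝ}

theorem unifProb_eq_expect (E : Ω → Prop) [DecidablePred E] :
    unifProb E = 𝔼 ω, if E ω then (1 : ℝ) else 0 := by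
  rw [Fintype.expect_eq_sum_div_card, sum_boole, unifProb, Nat.card_eq_fintype_card,
    Fintype.card_subtype]

theorem unifProb_mono (h : ∀ ω, E ω → F ω) : unifProb E ≤ unifProb F := by
  classical
  simp only [unifProb_eq_expect]
  exact expect_le_expect fun ω _ ↦ by split_ifs <;> simp_all

theorem unifProb_exists_mem_le {α : Type*} (s : Finset α) (E : α → Ω → Prop) :
    unifProb (fun ω ↦ ∃ a ∈ s, E a ω) ≤ ∑ a ∈ s, unifProb (E a) := by
  classical
  simp only [unifProb_eq_expect, ← expect_sum_comm]
  refine expect_le_expect fun ω _ ↦ ?_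
  split_ifs with h
  · obtain ⟨a, ha, hE⟩ := h
    exact (if_pos hE).ge.trans (single_le_sum (f := fun a ↦ if E a ω then (1 : ℝ) else 0)
      (fun _ _ ↦ by positivity) ha)
  · positivity

theorem unifProb_exists_le {α : Type*} [Fintype α] (E : α → Ω → Prop) :
    unifProb (fun ω ↦ ∃ a, E a ω) ≤ ∑ a, unifProb (E a) := by
  simpa using unifProb_exists_mem_le univ E

theorem unifProb_or_le : unifProb (fun ω ↦ E ω ∨ F ω) ≤ unifProb E + unifProb F := by
  refine (unifProb_mono ?_).trans ((unifProb_exists_le fun b : Bool ↦ cond b E F).trans_eq ?_)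
  · rintro ω (h | h)
    exacts [⟨true, h⟩, ⟨false, h⟩]
  · simp

theorem one_sub_le_unifProb [Nonempty Ω] (h : unifProb (fun ω ↦ ¬ E ω) ≤ δ) :
    1 - δ ≤ unifProb E := by
  classical
  simp only [unifProb_eq_expect] at h ⊢
  have hsum : 𝔼 ω, (if ¬ E ω then (1 : ℝ) else 0) + 𝔼 ω, (if E ω then (1 : ℝ) else 0) = 1 := by
    rw [← expect_add_distrib, ← Fintype.expect_one (ι := Ω) (M := ℝ)]
    exact expect_congr rfl fun ω _ ↦ by by_cases hω : E ω <;> simp [hω]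
  linarith

theorem unifProb_snd [Nonempty Ω'] (E : Ω → Prop) :
    unifProb (fun ω : Ω' × Ω ↦ E ω.2) = unifProb E := by
  classical
  rw [unifProb_eq_expect, unifProb_eq_expect, ← univ_product_univ, expect_product]
  exact Fintype.expect_const (𝔼 ω, if E ω then (1 : ℝ) else 0)

theorem unifProb_forall_apply {κ : Type} [Fintype κ] [DecidableEq κ] (P : Ω → Prop) :
    unifProb (fun z : κ → Ω ↦ ∀ j, P (z j)) = unifProb P ^ Fintype.card κ := by
  have hcard : Nat.card {z : κ → Ω // ∀ j, P (z j)} = Nat.card {ω // P ω} ^ Fintype.card κ := by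
    rw [Nat.card_congr (Equiv.subtypePiEquivPi (β := fun _ : κ ↦ Ω) (p := fun _ ↦ P)), Nat.card_pi]
    simp
  simp [unifProb, hcard, div_pow]

theorem unifProb_apply_equiv (e : Ω ≃ Ω') (E : Ω' → Prop) :
    unifProb (fun ω ↦ E (e ω)) = unifProb E := by
  classical
  simp only [unifProb_eq_expect]
  exact Fintype.expect_equiv e _ _ fun _ ↦ rfl

/-- Symmetrization: each `e s` preserves the uniform distribution, so the randomness may be moved
from `ω` to `s`. -/
theorem unifProb_le_of_forall_perm {S : Type} [Fintype S] [Nonempty S]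
    (e : S → Equiv.Perm Ω) (h : ∀ ω, unifProb (fun s ↦ E (e s ω)) ≤ c) (hc : 0 ≤ c) :
    unifProb E ≤ c := by
  classical
  calc unifProb E = 𝔼 s : S, 𝔼 ω, if E (e s ω) then (1 : ℝ) else 0 := by
        simp only [← unifProb_eq_expect, unifProb_apply_equiv]
        exact (Fintype.expect_const (unifProb E)).symm
    _ = 𝔼 ω, unifProb fun s ↦ E (e s ω) := by
        rw [expect_comm]
        exact expect_congr rfl fun ω _ ↦ (unifProb_eq_expect _).symm
    _ ≤ 𝔼 _ω : Ω, c := expect_le_expect fun ω _ ↦ h ω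
    _ ≤ c := by
        rcases isEmpty_or_nonempty Ω with hΩ | hΩ
        · simpa using hc
        · exact (Fintype.expect_const c).le

open MeasureTheory ProbabilityTheory in
theorem unifProb_eq_measureReal [MeasurableSpace Ω] [MeasurableSingletonClass Ω] (E : Ω → Prop) :
    unifProb E = (uniformOn Set.univ).real {ω | E ω} := by
  classical
  rw [measureReal_def, uniformOn_univ, ENNReal.toReal_div, unifProb, Nat.card_eq_fintype_card,
    Fintype.card_subtype, ← coe_filter_univ, Measure.count_apply_finset]
  simp

end UniformProbability

section Hoeffding

variable {ι Y : Type} [Fintype ι] [DecidableEq ι] [Fintype Y]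

open MeasureTheory ProbabilityTheory in
theorem integral_uniformOn_univ [MeasurableSpace Y] [MeasurableSingletonClass Y] (f : Y → ℝ) :
    ∫ y, f y ∂uniformOn Set.univ = 𝔼 y, f y := by
  simp [integral_fintype, Integrable.of_finite, Fintype.expect_eq_sum_div_card, measureReal_def,
    uniformOn_univ, ← mul_sum, div_eq_inv_mul]

open MeasureTheory ProbabilityTheory in
theorem unifProb_lt_sum_le_exp [Nonempty Y] (f : ι → Y → ℝ) (a : ι → ℝ)
    (hf : ∀ i y, |f i y| ≤ a i) (hmean : ∀ i, 𝔼 y, f i y = 0) {w t : ℝ} (hw : 0 ≤ w) (ht : 0 ≤ t)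
    (ha : ∑ i, a i ^ 2 ≤ w) :
    unifProb (fun y : ι → Y ↦ t < ∑ i, f i (y i)) ≤ Real.exp (-(t ^ 2 / (2 * w))) := by
  let _ : MeasurableSpace Y := ⊤
  have : DiscreteMeasurableSpace Y := ⟨fun _ ↦ trivial⟩
  set μ : Measure Y := uniformOn Set.univ
  have : IsProbabilityMeasure μ := isProbabilityMeasure_uniformOn Set.finite_univ Set.univ_nonempty
  have hpi : (uniformOn Set.univ : Measure (ι → Y)) = Measure.pi fun _ ↦ μ := by
    rw [← Set.pi_univ Set.univ, uniformOn_pi]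
  have hsub : ∀ i ∈ univ, HasSubgaussianMGF (fun y : ι → Y ↦ f i (y i))
      ((‖a i - -a i‖₊ / 2) ^ 2) (Measure.pi fun _ ↦ μ) := fun i _ ↦ by
    refine hasSubgaussianMGF_of_mem_Icc_of_integral_eq_zero (.of_discrete)
      (.of_forall fun y ↦ abs_le.1 (hf i (y i))) ?_
    rw [← hmean i, ← integral_uniformOn_univ]
    exact integral_comp_eval (X := fun _ ↦ Y) (μ := fun _ ↦ μ) (f := f i) .of_discrete
  have hsum := HasSubgaussianMGF.sum_of_iIndepFun
    (iIndepFun_pi fun i ↦ (Measurable.of_discrete (f := f i)).aemeasurable) hsub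
  have hle : ((∑ i, (‖a i - -a i‖₊ / 2) ^ 2 : NNReal) : ℝ) ≤ w := by
    simpa [← two_mul, div_pow, mul_pow] using ha
  have hw' : HasSubgaussianMGF (fun y : ι → Y ↦ ∑ i, f i (y i)) ⟨w, hw⟩
      (Measure.pi fun _ ↦ μ) :=
    ⟨hsum.integrable_exp_mul, fun l ↦ (hsum.mgf_le l).trans (by gcongr; exact hle)⟩
  calc unifProb (fun y : ι → Y ↦ t < ∑ i, f i (y i))
      ≤ unifProb (fun y : ι → Y ↦ t ≤ ∑ i, f i (y i)) := unifProb_mono fun _ ↦ le_of_lt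
    _ ≤ Real.exp (-(t ^ 2 / (2 * w))) := by
        rw [unifProb_eq_measureReal, hpi, ← neg_div]
        exact hw'.measure_ge_le ht

end Hoeffding

section VCDimension

variable {α β : Type*} [Fintype α] [DecidableEq β]

/-- The preimage of a finite set under a map out of a finite type. For a tuple `f : Fin s → β`, it
is the trace of the set along the tuple. -/
def pullback (f : α → β) (A : Finset β) : Finset α := {a | f a ∈ A}

@[simp]
theorem mem_pullback {f : α → β} {A : Finset β} {a : α} : a ∈ pullback f A ↔ f a ∈ A := by
  simp [pullback]

theorem vcDim_image_pullback_le [DecidableEq α] (f : α → β) (𝒜 : Finset (Finset β)) :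
    (𝒜.image (pullback f)).vcDim ≤ 𝒜.vcDim := by
  refine Finset.sup_le fun s hs ↦ ?_
  rw [mem_shatterer] at hs
  have hinj : Set.InjOn f s := fun a ha b hb hab ↦ by
    obtain ⟨_, hA, hsA⟩ := hs.exists_inter_eq_singleton ha
    obtain ⟨A, -, rfl⟩ := mem_image.1 hA
    have haA : a ∈ s ∩ pullback f A := hsA ▸ mem_singleton_self a
    have hbA : b ∈ s ∩ pullback f A :=
      mem_inter.2 ⟨hb, mem_pullback.2 (hab ▸ mem_pullback.1 (mem_inter.1 haA).2)⟩
    rw [hsA] at hbA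
    exact (mem_singleton.1 hbA).symm
  rw [← card_image_of_injOn hinj]
  refine Shatters.card_le_vcDim fun t ht ↦ ?_
  obtain ⟨u, hu, rfl⟩ := subset_image_iff.1 ht
  obtain ⟨_, hA, hsA⟩ := hs (mod_cast hu)
  obtain ⟨A, hA𝒜, rfl⟩ := mem_image.1 hA
  refine ⟨A, hA𝒜, ?_⟩
  ext b
  simp only [← hsA, mem_inter, mem_image, mem_pullback]
  grind

theorem card_le_of_vcDim_le [DecidableEq α] {𝒜 : Finset (Finset α)} {V : ℕ}
    (h𝒜 : 𝒜.vcDim ≤ V) {t : ℝ} (ht : 0 < t) (ht1 : t ≤ 1) :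
    (#𝒜 : ℝ) ≤ (1 / t) ^ V * (1 + t) ^ Fintype.card α := by
  have hone : ∀ s ∈ 𝒜.shatterer, 1 ≤ (1 / t) ^ V * t ^ #s := fun s hs ↦ by
    have hsV : t ^ V ≤ t ^ #s :=
      pow_le_pow_of_le_one ht.le ht1 (((mem_shatterer.1 hs).card_le_vcDim).trans h𝒜)
    rw [one_div, inv_pow]
    exact (inv_mul_cancel₀ (pow_pos ht V).ne').ge.trans (by gcongr)
  calc (#𝒜 : ℝ) ≤ #𝒜.shatterer := mod_cast card_le_card_shatterer 𝒜
    _ ≤ ∑ s ∈ 𝒜.shatterer, (1 / t) ^ V * t ^ #s := by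
        simpa using sum_le_sum hone
    _ ≤ ∑ s : Finset α, (1 / t) ^ V * t ^ #s :=
        sum_le_univ_sum_of_nonneg fun _ ↦ by positivity
    _ = (1 / t) ^ V * (1 + t) ^ Fintype.card α := by
        rw [← mul_sum, add_comm 1 t, ← Fintype.sum_pow_mul_eq_add_pow α t 1]
        simp

end VCDimension

section Packing

variable {ι : Type} [Fintype ι] [DecidableEq ι]

omit [DecidableEq ι] in
theorem unifProb_notMem [Nonempty ι] (D : Finset ι) :
    unifProb (fun i ↦ i ∉ D) = 1 - #D / Fintype.card ι := by
  classical
  have hD : (#Dᶜ : ℝ) = Fintype.card ι - #D := by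
    rw [card_compl, Nat.cast_sub (card_le_univ D)]
  rw [one_sub_div (by simp), ← hD, unifProb]
  simp [Fintype.card_subtype_compl, card_compl]

/-- A random tuple misses a given symmetric difference with small probability, so a long enough one
tells all members of the family apart. -/
theorem exists_injOn_pullback [Nonempty ι] {𝒢 : Finset (Finset ι)} {ρ : ℝ} {s : ℕ}
    (hsep : (𝒢 : Set (Finset ι)).Pairwise fun A B ↦ ρ * Fintype.card ι < #(A ∆ B))
    (hs : (#𝒢 : ℝ) ^ 2 * Real.exp (-(ρ * s)) < 1) :
    ∃ z : Fin s → ι, Set.InjOn (pullback z) 𝒢 := by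
  by_contra! hnot
  have hmiss (z : Fin s → ι) : ∃ p ∈ 𝒢.offDiag, ∀ j, z j ∉ p.1 ∆ p.2 := by
    obtain ⟨A, hA, B, hB, hAB, hne⟩ : ∃ A ∈ 𝒢, ∃ B ∈ 𝒢, pullback z A = pullback z B ∧ A ≠ B := by
      simpa [Set.InjOn] using hnot z
    refine ⟨(A, B), mem_offDiag.2 ⟨hA, hB, hne⟩, fun j ↦ ?_⟩
    have : z j ∈ A ↔ z j ∈ B := by simpa using Finset.ext_iff.1 hAB j
    simp [mem_symmDiff, this]
  have hpair : ∀ p ∈ 𝒢.offDiag,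
      unifProb (fun z : Fin s → ι ↦ ∀ j, z j ∉ p.1 ∆ p.2) ≤ Real.exp (-(ρ * s)) := fun p hp ↦ by
    obtain ⟨hA, hB, hne⟩ := mem_offDiag.1 hp
    have hn : (0 : ℝ) < Fintype.card ι := mod_cast Fintype.card_pos
    have hρ : ρ ≤ #(p.1 ∆ p.2) / Fintype.card ι := by
      rw [le_div_iff₀ hn]
      exact (hsep hA hB hne).le
    have hle : (#(p.1 ∆ p.2) : ℝ) / Fintype.card ι ≤ 1 :=
      div_le_one_of_le₀ (mod_cast card_le_univ _) hn.le
    rw [unifProb_forall_apply (· ∉ p.1 ∆ p.2), unifProb_notMem, Fintype.card_fin, mul_comm,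
      ← mul_neg, Real.exp_nat_mul]
    exact pow_le_pow_left₀ (sub_nonneg.2 hle) (by linarith [Real.add_one_le_exp (-ρ)]) s
  have hcard : (#𝒢.offDiag : ℝ) ≤ (#𝒢 : ℝ) ^ 2 := by
    rw [sq]
    exact_mod_cast (offDiag_card 𝒢).trans_le (Nat.sub_le _ _)
  have htotal : (1 : ℝ) ≤ #𝒢.offDiag * Real.exp (-(ρ * s)) := by
    calc (1 : ℝ) = unifProb fun _ : Fin s → ι ↦ True := by simp [unifProb_eq_expect]
      _ ≤ unifProb fun z : Fin s → ι ↦ ∃ p ∈ 𝒢.offDiag, ∀ j, z j ∉ p.1 ∆ p.2 :=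
          unifProb_mono fun z _ ↦ hmiss z
      _ ≤ _ := (unifProb_exists_mem_le _ _).trans (sum_le_card_nsmul _ _ _ hpair)
      _ = _ := nsmul_eq_mul _ _
  exact absurd hs (not_lt.2 (htotal.trans (by gcongr)))

theorem exists_nat_mul_mem_Ioc {ρ c : ℝ} (hρ : 0 < ρ) (hc : 0 ≤ c) :
    ∃ s : ℕ, ρ * s ∈ Set.Ioc c (c + ρ) := by
  refine ⟨⌊c / ρ⌋₊ + 1, ?_, ?_⟩
  · rw [mul_comm, ← div_lt_iff₀ hρ]
    exact_mod_cast Nat.lt_floor_add_one (c / ρ)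
  · have := Nat.floor_le (div_nonneg hc hρ.le)
    rw [le_div_iff₀ hρ] at this
    push_cast
    linarith

theorem card_le_of_separated [Nonempty ι] {V : ℕ} {𝒢 : Finset (Finset ι)} (hV : 𝒢.vcDim ≤ V)
    {ρ : ℝ} (hρ : 0 < ρ) (hρ1 : ρ ≤ 1)
    (hsep : (𝒢 : Set (Finset ι)).Pairwise fun A B ↦ ρ * Fintype.card ι < #(A ∆ B)) :
    (#𝒢 : ℝ) ≤ Real.exp 1 * (4 / ρ) ^ (2 * V) := by
  rcases 𝒢.eq_empty_or_nonempty with rfl | hne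
  · simp only [card_empty, Nat.cast_zero]
    positivity
  have hcard : (1 : ℝ) ≤ #𝒢 := mod_cast hne.card_pos
  set L := Real.log #𝒢
  have hexp : (#𝒢 : ℝ) = Real.exp L := (Real.exp_log (by linarith)).symm
  have hL0 : 0 ≤ L := Real.log_nonneg hcard
  obtain ⟨s, hs, hs'⟩ := exists_nat_mul_mem_Ioc hρ (mul_nonneg two_pos.le hL0)
  obtain ⟨z, hz⟩ := exists_injOn_pullback (s := s) hsep (by
    rw [hexp, ← Real.exp_nat_mul, ← Real.exp_add, Real.exp_lt_one_iff]
    push_cast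
    linarith)
  have htrace := card_le_of_vcDim_le ((vcDim_image_pullback_le z 𝒢).trans hV)
    (by positivity : 0 < ρ / 4) (by linarith)
  rw [card_image_of_injOn hz, Fintype.card_fin, one_div_div] at htrace
  have hpow : (1 + ρ / 4) ^ s ≤ Real.exp (L / 2 + 1 / 2) := by
    calc (1 + ρ / 4) ^ s ≤ Real.exp (ρ / 4) ^ s := by
          gcongr
          linarith [Real.add_one_le_exp (ρ / 4)]
      _ = Real.exp (s * (ρ / 4)) := (Real.exp_nat_mul _ _).symm
      _ ≤ _ := Real.exp_le_exp.2 (by linarith)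
  have hhalf : Real.exp (L / 2) ≤ (4 / ρ) ^ V * Real.exp (1 / 2) := by
    refine le_of_mul_le_mul_right ?_ (Real.exp_pos (L / 2))
    calc Real.exp (L / 2) * Real.exp (L / 2) = #𝒢 := by
          rw [hexp, ← Real.exp_add, add_halves]
      _ ≤ (4 / ρ) ^ V * Real.exp (L / 2 + 1 / 2) := htrace.trans (by gcongr)
      _ = _ := by
          rw [Real.exp_add]
          ring
  calc (#𝒢 : ℝ) = Real.exp (L / 2) ^ 2 := by rw [hexp, ← Real.exp_nat_mul]; ring_nf
    _ ≤ ((4 / ρ) ^ V * Real.exp (1 / 2)) ^ 2 := by gcongr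
    _ = _ := by rw [mul_pow, ← Real.exp_nat_mul, ← pow_mul]; ring_nf

theorem exists_separated_net {α : Type*} [DecidableEq α] (𝒜 : Finset (Finset α)) {r : ℝ}
    (hr : 0 ≤ r) :
    ∃ 𝒢 ⊆ 𝒜, (𝒢 : Set (Finset α)).Pairwise (fun A B ↦ r < #(A ∆ B)) ∧
      ∀ A ∈ 𝒜, ∃ B ∈ 𝒢, (#(A ∆ B) : ℝ) ≤ r := by
  classical
  let separated : Finset (Finset (Finset α)) :=
    {𝒢 ∈ 𝒜.powerset | (𝒢 : Set (Finset α)).Pairwise fun A B ↦ r < #(A ∆ B)}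
  obtain ⟨𝒢, h𝒢, hmax⟩ := separated.exists_maximal ⟨∅, by simp [separated]⟩
  simp only [separated, mem_filter, mem_powerset] at h𝒢 hmax
  refine ⟨𝒢, h𝒢.1, h𝒢.2, fun A hA ↦ ?_⟩
  by_contra! hfar
  have hins : insert A 𝒢 ⊆ 𝒢 := by
    refine hmax ⟨insert_subset hA h𝒢.1, ?_⟩ (Finset.subset_insert _ _)
    rw [coe_insert]
    exact h𝒢.2.insert fun B hB _ ↦ ⟨hfar B hB, symmDiff_comm A B ▸ hfar B hB⟩
  exact (hfar A (hins (mem_insert_self A 𝒢))).not_ge (by simpa using hr)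

end Packing

section Chaining

variable {ι : Type} [Fintype ι] [DecidableEq ι] {𝒜 : Finset (Finset ι)} {V : ℕ} {α M : ℝ}

/-- The Rademacher process of the signs `σ`, indexed by sets. -/
def signSum {ι : Type*} (σ : ι → ℤˣ) (A : Finset ι) : ℝ := ∑ i ∈ A, ((σ i : ℤ) : ℝ)

theorem unifProb_lt_signSum_sub_le {A B : Finset ι} {r t : ℝ} (hr : #(A ∆ B) ≤ r) (ht : 0 ≤ t) :
    unifProb (fun σ : ι → ℤˣ ↦ t < signSum σ A - signSum σ B) ≤ Real.exp (-(t ^ 2 / (2 * r))) := by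
  let f (i : ι) (s : ℤˣ) : ℝ := ((s : ℤ) : ℝ) * ((if i ∈ A then 1 else 0) - if i ∈ B then 1 else 0)
  let a (i : ι) : ℝ := if i ∈ A ∆ B then 1 else 0
  have hf (i : ι) (s : ℤˣ) : |f i s| ≤ a i := by
    rcases Int.units_eq_one_or s with rfl | rfl <;>
      by_cases hA : i ∈ A <;> by_cases hB : i ∈ B <;> simp [f, a, hA, hB, mem_symmDiff]
  have hmean (i : ι) : 𝔼 s, f i s = 0 := by
    have huniv : (univ : Finset ℤˣ) = {1, -1} := rfl
    rw [← expect_mul, Fintype.expect_eq_sum_div_card, huniv, sum_pair (by decide)]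
    simp
  have hsum (σ : ι → ℤˣ) : signSum σ A - signSum σ B = ∑ i, f i (σ i) := by
    simp [signSum, f, mul_sub, sum_sub_distrib]
  have ha : ∑ i, a i ^ 2 ≤ r := by simpa [a] using hr
  simp only [hsum]
  exact unifProb_lt_sum_le_exp f a hf hmean ((Nat.cast_nonneg _).trans hr) ht ha

theorem exists_nets [Nonempty ι] (hV : 𝒜.vcDim ≤ V) :
    ∃ 𝒢 : ℕ → Finset (Finset ι), 𝒢 0 = {∅} ∧ (∀ j, (#(𝒢 j) : ℝ) ≤ Real.exp (4 * V * (j + 1) + 1)) ∧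
      ∀ j, ∀ A ∈ 𝒜, ∃ B ∈ 𝒢 j, (#(A ∆ B) : ℝ) ≤ Fintype.card ι * (1 / 4) ^ j := by
  have hnet (j : ℕ) : ∃ 𝒢 : Finset (Finset ι), (#𝒢 : ℝ) ≤ Real.exp (4 * V * (j + 1) + 1) ∧
      ∀ A ∈ 𝒜, ∃ B ∈ 𝒢, (#(A ∆ B) : ℝ) ≤ Fintype.card ι * (1 / 4) ^ j := by
    obtain ⟨𝒢, hsub, hsep, hnet⟩ := exists_separated_net 𝒜
      (by positivity : (0 : ℝ) ≤ (1 / 4) ^ j * Fintype.card ι)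
    refine ⟨𝒢, ?_, by simpa only [mul_comm] using hnet⟩
    have hfour : (4 : ℝ) ≤ Real.exp 2 := by
      have hexp : Real.exp 2 = Real.exp 1 * Real.exp 1 := by
        rw [← Real.exp_add]
        norm_num
      nlinarith [Real.exp_one_gt_d9]
    calc (#𝒢 : ℝ) ≤ Real.exp 1 * (4 / (1 / 4) ^ j) ^ (2 * V) :=
          card_le_of_separated ((vcDim_mono hsub).trans hV) (by positivity)
            (pow_le_one₀ (by norm_num) (by norm_num)) hsep
      _ = Real.exp 1 * 4 ^ ((j + 1) * (2 * V)) := by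
          rw [one_div, inv_pow, div_inv_eq_mul, ← pow_succ', ← pow_mul]
      _ ≤ Real.exp 1 * Real.exp 2 ^ ((j + 1) * (2 * V)) := by gcongr
      _ = Real.exp (4 * V * (j + 1) + 1) := by
          rw [← Real.exp_nat_mul, ← Real.exp_add]
          push_cast
          ring_nf
  choose 𝒢 hcard hnet using hnet
  refine ⟨fun j ↦ if j = 0 then {∅} else 𝒢 j, if_pos rfl, fun j ↦ ?_, fun j A hA ↦ ?_⟩
  · beta_reduce
    split_ifs with hj
    · simpa using (by positivity : (0 : ℝ) ≤ 4 * V * (j + 1) + 1)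
    · exact hcard j
  · beta_reduce
    split_ifs with hj
    · exact ⟨∅, mem_singleton_self _, by simpa [hj, ← bot_eq_empty] using card_le_univ A⟩
    · exact hnet j A hA

/-- A large value of the process at the end of a chain forces a large increment along one of its
links, where the thresholds `n * α / 4 * (3 / 4) ^ j` sum to at most `n * α`. -/
theorem exists_lt_signSum_sub {𝒢 : ℕ → Finset (Finset ι)} (h𝒢 : 𝒢 0 = {∅}) {A : Finset ι}
    (hnet : ∀ j, ∃ B ∈ 𝒢 j, (#(A ∆ B) : ℝ) ≤ Fintype.card ι * (1 / 4) ^ j) (hα : 0 ≤ α) {J : ℕ}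
    (hJ : Fintype.card ι * (1 / 4 : ℝ) ^ J < 1) {σ : ι → ℤˣ}
    (hA : Fintype.card ι * α < signSum σ A) :
    ∃ j < J, ∃ p ∈ 𝒢 (j + 1) ×ˢ 𝒢 j, (#(p.1 ∆ p.2) : ℝ) ≤ 2 * (Fintype.card ι * (1 / 4) ^ j) ∧
      Fintype.card ι * α / 4 * (3 / 4) ^ j < signSum σ p.1 - signSum σ p.2 := by
  choose B hB𝒢 hB using hnet
  have hB0 : B 0 = ∅ := by simpa [h𝒢] using hB𝒢 0
  have hBJ : B J = A := by
    have : #(A ∆ B J) < 1 := by exact_mod_cast (hB J).trans_lt hJ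
    simpa [eq_comm] using this
  have htelescope : ∑ j ∈ range J, (signSum σ (B (j + 1)) - signSum σ (B j)) = signSum σ A := by
    rw [sum_range_sub (fun j ↦ signSum σ (B j)), hBJ, hB0]
    simp [signSum]
  have hthresholds : ∑ j ∈ range J, Fintype.card ι * α / 4 * (3 / 4 : ℝ) ^ j
      ≤ Fintype.card ι * α := by
    have hgeom : ∑ j ∈ range J, (3 / 4 : ℝ) ^ j ≤ 4 := by
      rw [geom_sum_eq (by norm_num), div_le_iff_of_neg (by norm_num)]
      have : (0 : ℝ) ≤ (3 / 4) ^ J := by positivity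
      linarith
    rw [← mul_sum]
    calc _ ≤ Fintype.card ι * α / 4 * 4 := by gcongr
      _ = _ := by ring
  obtain ⟨j, hj, hlt⟩ := exists_lt_of_sum_lt (hthresholds.trans_lt (hA.trans_eq htelescope.symm))
  refine ⟨j, mem_range.1 hj, (B (j + 1), B j), mk_mem_product (hB𝒢 _) (hB𝒢 _), ?_, hlt⟩
  have htriangle : (#(B (j + 1) ∆ B j) : ℝ) ≤ #(A ∆ B (j + 1)) + #(A ∆ B j) := by
    rw [symmDiff_comm A (B (j + 1))]
    exact_mod_cast (card_le_card (symmDiff_triangle _ A _)).trans (card_union_le _ _)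
  have := hB (j + 1)
  have : (0 : ℝ) ≤ Fintype.card ι * (1 / 4) ^ j := by positivity
  rw [pow_succ] at *
  linarith [hB j]

theorem chain_exponent_le {V M x : ℝ} (hV : 1 ≤ V) (hM : 1 ≤ M) (hx : 16 * (V * M) ≤ x) (j : ℕ) :
    (4 * V * (j + 2) + 1) + (4 * V * (j + 1) + 1) - x * (9 / 4) ^ j ≤ -M - (j + 1) := by
  have hbern : 1 + (j : ℝ) * (5 / 4) ≤ (9 / 4) ^ j := by
    simpa [show (1 : ℝ) + 5 / 4 = 9 / 4 by norm_num] using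
      one_add_mul_le_pow (by norm_num : (-2 : ℝ) ≤ 5 / 4) j
  have hVM : V ≤ V * M := le_mul_of_one_le_right (by linarith) hM
  have hMV : M ≤ V * M := le_mul_of_one_le_left (by linarith) hV
  have hgrowth : 16 * (V * M) * (1 + (j : ℝ) * (5 / 4)) ≤ x * (9 / 4) ^ j :=
    mul_le_mul hx hbern (by positivity) (by linarith)
  have hj : (j : ℝ) * V ≤ j * (V * M) := by gcongr
  have hj' : (j : ℝ) ≤ j * (V * M) := le_mul_of_one_le_right j.cast_nonneg (by linarith)
  linarith

theorem unifProb_link_le (A B : Finset ι) (j : ℕ) (hn : 0 < Fintype.card ι) (hα : 0 ≤ α) :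
    unifProb (fun σ : ι → ℤˣ ↦ (#(A ∆ B) : ℝ) ≤ 2 * (Fintype.card ι * (1 / 4) ^ j) ∧
      Fintype.card ι * α / 4 * (3 / 4) ^ j < signSum σ A - signSum σ B)
      ≤ Real.exp (-(Fintype.card ι * α ^ 2 / 64 * (9 / 4) ^ j)) := by
  by_cases hAB : (#(A ∆ B) : ℝ) ≤ 2 * (Fintype.card ι * (1 / 4) ^ j)
  · have hpow : (9 / 4 : ℝ) ^ j * (1 / 4) ^ j = ((3 / 4) ^ j) ^ 2 := by
      rw [← mul_pow, ← pow_mul, mul_comm j, pow_mul]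
      norm_num
    simp only [hAB, true_and]
    refine (unifProb_lt_signSum_sub_le hAB (by positivity)).trans_eq ?_
    congr 2
    rw [div_eq_iff (by positivity)]
    linear_combination -(Fintype.card ι : ℝ) ^ 2 * α ^ 2 / 16 * hpow
  · simp only [hAB, false_and]
    simpa [unifProb_eq_expect] using (Real.exp_pos _).le

theorem unifProb_exists_link_le {𝒢 ℋ : Finset (Finset ι)} {j : ℕ}
    (h𝒢 : (#𝒢 : ℝ) ≤ Real.exp (4 * V * (j + 2) + 1))
    (hℋ : (#ℋ : ℝ) ≤ Real.exp (4 * V * (j + 1) + 1)) (hα : 0 ≤ α) (hV : 1 ≤ V) (hM : 1 ≤ M)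
    (hn : 1024 * (V * M) ≤ Fintype.card ι * α ^ 2) :
    unifProb (fun σ : ι → ℤˣ ↦ ∃ p ∈ 𝒢 ×ˢ ℋ,
      (#(p.1 ∆ p.2) : ℝ) ≤ 2 * (Fintype.card ι * (1 / 4) ^ j) ∧
      Fintype.card ι * α / 4 * (3 / 4) ^ j < signSum σ p.1 - signSum σ p.2)
      ≤ Real.exp (-M) * (1 / 2) ^ (j + 1) := by
  have hV' : (1 : ℝ) ≤ V := mod_cast hV
  have hcard : 0 < Fintype.card ι := Nat.pos_of_ne_zero fun h ↦ by
    rw [h, Nat.cast_zero, zero_mul] at hn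
    nlinarith
  set x : ℝ := Fintype.card ι * α ^ 2 / 64
  calc _ ≤ ∑ p ∈ 𝒢 ×ˢ ℋ, Real.exp (-(x * (9 / 4) ^ j)) :=
        (unifProb_exists_mem_le _ _).trans
          (sum_le_sum fun p _ ↦ unifProb_link_le p.1 p.2 j hcard hα)
    _ = #𝒢 * #ℋ * Real.exp (-(x * (9 / 4) ^ j)) := by
        rw [sum_const, nsmul_eq_mul, card_product, Nat.cast_mul]
    _ ≤ Real.exp (4 * V * (j + 2) + 1) * Real.exp (4 * V * (j + 1) + 1)
          * Real.exp (-(x * (9 / 4) ^ j)) := by gcongr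
    _ = Real.exp ((4 * V * (j + 2) + 1) + (4 * V * (j + 1) + 1) - x * (9 / 4) ^ j) := by
        rw [← Real.exp_add, ← Real.exp_add, sub_eq_add_neg]
    _ ≤ Real.exp (-M - (j + 1)) :=
        Real.exp_le_exp.2 (chain_exponent_le hV' hM (by simp only [x]; linarith) j)
    _ = Real.exp (-M) * (Real.exp (-1)) ^ (j + 1) := by
        rw [← Real.exp_nat_mul, ← Real.exp_add]
        push_cast
        ring_nf
    _ ≤ Real.exp (-M) * (1 / 2) ^ (j + 1) := by
        gcongr
        rw [Real.exp_neg, one_div]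
        gcongr
        linarith [Real.exp_one_gt_d9]

theorem unifProb_exists_lt_signSum_le (h𝒜 : 𝒜.vcDim ≤ V) (hα : 0 ≤ α) (hV : 1 ≤ V) (hM : 1 ≤ M)
    (hn : 1024 * (V * M) ≤ Fintype.card ι * α ^ 2) :
    unifProb (fun σ : ι → ℤˣ ↦ ∃ A ∈ 𝒜, Fintype.card ι * α < signSum σ A) ≤ Real.exp (-M) := by
  have hn0 : 0 < Fintype.card ι := Nat.pos_of_ne_zero fun h ↦ by
    have hV' : (1 : ℝ) ≤ V := mod_cast hV
    rw [h, Nat.cast_zero, zero_mul] at hn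
    nlinarith
  have : Nonempty ι := Fintype.card_pos_iff.1 hn0
  obtain ⟨𝒢, h𝒢0, hcard, hnet⟩ := exists_nets h𝒜
  obtain ⟨J, hJ⟩ : ∃ J : ℕ, Fintype.card ι * (1 / 4 : ℝ) ^ J < 1 := by
    obtain ⟨J, hJ⟩ := exists_pow_lt_of_lt_one (by positivity : (0 : ℝ) < (Fintype.card ι : ℝ)⁻¹)
      (by norm_num : (1 / 4 : ℝ) < 1)
    have hlt := mul_lt_mul_of_pos_left hJ (by positivity : (0 : ℝ) < Fintype.card ι)
    exact ⟨J, hlt.trans_eq (mul_inv_cancel₀ (by positivity))⟩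
  calc _ ≤ unifProb (fun σ : ι → ℤˣ ↦ ∃ j ∈ range J, ∃ p ∈ 𝒢 (j + 1) ×ˢ 𝒢 j,
        (#(p.1 ∆ p.2) : ℝ) ≤ 2 * (Fintype.card ι * (1 / 4) ^ j) ∧
        Fintype.card ι * α / 4 * (3 / 4) ^ j < signSum σ p.1 - signSum σ p.2) := by
        refine unifProb_mono fun σ ⟨A, hA, hlt⟩ ↦ ?_
        simpa only [mem_range] using
          exists_lt_signSum_sub h𝒢0 (fun j ↦ hnet j A hA) hα hJ hlt
    _ ≤ ∑ j ∈ range J, Real.exp (-M) * (1 / 2) ^ (j + 1) := by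
        refine (unifProb_exists_mem_le _ _).trans (sum_le_sum fun j _ ↦ ?_)
        refine unifProb_exists_link_le ((hcard (j + 1)).trans_eq ?_) (hcard j) hα hV hM hn
        push_cast
        ring_nf
    _ = Real.exp (-M) * ((∑ j ∈ range J, (1 / 2) ^ j) * (1 / 2)) := by
        rw [← mul_sum, sum_mul]
        simp only [pow_succ]
    _ ≤ Real.exp (-M) := by
        have := sum_geometric_two_le J
        exact mul_le_of_le_one_right (Real.exp_pos _).le (by linarith)

end Chaining

section Symmetrization

variable {ι X : Type} {V : ℕ} {α M : ℝ}

/-- The exchange of the entries of a pair of samples at the indices of sign `-1`. -/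
def swapBy (σ : ι → ℤˣ) (ω : (ι → X) × (ι → X)) : (ι → X) × (ι → X) :=
  (fun i ↦ if σ i = 1 then ω.1 i else ω.2 i, fun i ↦ if σ i = 1 then ω.2 i else ω.1 i)

theorem swapBy_involutive (σ : ι → ℤˣ) : Function.Involutive (swapBy (X := X) σ) := fun ω ↦ by
  ext i <;> by_cases h : σ i = 1 <;> simp [swapBy, h]

variable [Fintype ι] [DecidableEq X]

theorem card_pullback_swapBy_sub (σ : ι → ℤˣ) (ω : (ι → X) × (ι → X)) (C : Finset X) :
    (#(pullback (swapBy σ ω).1 C) - #(pullback (swapBy σ ω).2 C) : ℝ)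
      = signSum σ (pullback ω.1 C) + signSum (-σ) (pullback ω.2 C) := by
  simp only [signSum, pullback, sum_filter, card_filter, Nat.cast_sum, ← sum_sub_distrib,
    ← sum_add_distrib]
  refine sum_congr rfl fun i _ ↦ ?_
  rcases Int.units_eq_one_or (σ i) with h | h <;>
    by_cases h₁ : ω.1 i ∈ C <;> by_cases h₂ : ω.2 i ∈ C <;> simp [swapBy, h, h₁, h₂]

variable [DecidableEq ι] {𝒞 : Finset (Finset X)}

theorem unifProb_exists_lt_signSum_pullback_le (h𝒞 : 𝒞.vcDim ≤ V) (hα : 0 ≤ α) (hV : 1 ≤ V)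
    (hM : 1 ≤ M) (hn : 1024 * (V * M) ≤ Fintype.card ι * α ^ 2) (x : ι → X) :
    unifProb (fun σ : ι → ℤˣ ↦ ∃ C ∈ 𝒞, Fintype.card ι * α < signSum σ (pullback x C))
      ≤ Real.exp (-M) := by
  simpa only [mem_image, exists_exists_and_eq_and] using
    unifProb_exists_lt_signSum_le ((vcDim_image_pullback_le x 𝒞).trans h𝒞) hα hV hM hn

theorem unifProb_exists_card_pullback_lt_le [Fintype X] (h𝒞 : 𝒞.vcDim ≤ V) (hα : 0 ≤ α) (hV : 1 ≤ V)
    (hM : 1 ≤ M) (hn : 1024 * (V * M) ≤ Fintype.card ι * (α / 2) ^ 2) :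
    unifProb (fun ω : (ι → X) × (ι → X) ↦
      ∃ C ∈ 𝒞, #(pullback ω.2 C) + Fintype.card ι * α < #(pullback ω.1 C))
      ≤ 2 * Real.exp (-M) := by
  refine unifProb_le_of_forall_perm (fun σ ↦ (swapBy_involutive σ).toPerm) (fun ω ↦ ?_)
    (by positivity)
  have hbound := unifProb_exists_lt_signSum_pullback_le h𝒞 (by positivity) hV hM hn
  have hneg : unifProb (fun σ : ι → ℤˣ ↦
      ∃ C ∈ 𝒞, Fintype.card ι * (α / 2) < signSum (-σ) (pullback ω.2 C)) ≤ Real.exp (-M) :=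
    (unifProb_apply_equiv (Equiv.neg _) fun σ : ι → ℤˣ ↦
      ∃ C ∈ 𝒞, Fintype.card ι * (α / 2) < signSum σ (pullback ω.2 C)).trans_le (hbound ω.2)
  rw [two_mul]
  simp only [Function.Involutive.coe_toPerm]
  refine (unifProb_mono fun σ ⟨C, hC, hlt⟩ ↦ ?_).trans
    (unifProb_or_le.trans (add_le_add (hbound ω.1) hneg))
  by_contra! hle
  linarith [card_pullback_swapBy_sub σ ω C, hle.1 C hC, hle.2 C hC]

end Symmetrization

section PositivitySets

variable {X : Type*} {W : Submodule ℝ (X → ℝ)}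

theorem exists_pos_sum_mul_eq_zero [Finite X] {s : Finset X} (hs : Module.finrank ℝ W < #s) :
    ∃ b : s → ℝ, (∃ i, 0 < b i) ∧ ∀ f ∈ W, ∑ i, b i * f i = 0 := by
  let ev (i : s) : Module.Dual ℝ W := LinearMap.proj (i : X) ∘ₗ W.subtype
  have hdep : ¬ LinearIndependent ℝ ev := fun h ↦ by
    have := h.fintype_card_le_finrank
    rw [Subspace.dual_finrank_eq, Fintype.card_coe] at this
    lia
  obtain ⟨b, hb, i, hi⟩ := Fintype.not_linearIndependent_iff.1 hdep
  have hsum (f : X → ℝ) (hf : f ∈ W) : ∑ i, b i * f i = 0 := by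
    simpa [ev] using LinearMap.congr_fun hb ⟨f, hf⟩
  rcases lt_or_gt_of_ne hi with hi | hi
  · exact ⟨-b, ⟨i, by simpa using hi⟩, fun f hf ↦ by simpa using hsum f hf⟩
  · exact ⟨b, ⟨i, hi⟩, hsum⟩

open Classical in
/-- The positivity sets of the functions in a linear space of functions. -/
noncomputable def posSets [Fintype X] (W : Submodule ℝ (X → ℝ)) : Finset (Finset X) :=
  {A | ∃ f ∈ W, ∀ x, x ∈ A ↔ 0 < f x}

variable [Fintype X]

theorem mem_posSets {A : Finset X} : A ∈ posSets W ↔ ∃ f ∈ W, ∀ x, x ∈ A ↔ 0 < f x := by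
  simp [posSets]

theorem vcDim_posSets_le [DecidableEq X] : (posSets W).vcDim ≤ Module.finrank ℝ W := by
  refine Finset.sup_le fun s hs ↦ ?_
  by_contra! hlt
  obtain ⟨b, ⟨i₀, hi₀⟩, horth⟩ := exists_pos_sum_mul_eq_zero hlt
  obtain ⟨A, hA, hsA⟩ := mem_shatterer.1 hs
    (map_subtype_subset {i : s | 0 < b i})
  obtain ⟨f, hf, hfA⟩ := mem_posSets.1 hA
  have hsign (i : s) : 0 < f i ↔ 0 < b i := by
    simpa [← hfA] using Finset.ext_iff.1 hsA i
  have hpos : 0 < ∑ i, b i * f i := by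
    refine sum_pos' (fun i _ ↦ ?_) ⟨i₀, mem_univ _, mul_pos hi₀ ((hsign i₀).2 hi₀)⟩
    by_cases hi : 0 < b i
    · exact (mul_pos hi ((hsign i).2 hi)).le
    · exact mul_nonneg_of_nonpos_of_nonpos (not_lt.1 hi) (not_lt.1 (mt (hsign i).1 hi))
  exact hpos.ne' (horth f hf)

end PositivitySets

section Monomials

theorem card_filter_nonempty_card_le {α : Type*} [Fintype α] (k : ℕ) :
    #{I : Finset α | I.Nonempty ∧ #I ≤ k} ≤ Fintype.card α ^ k := by
  classical
  have hsub : ({I : Finset α | I.Nonempty ∧ #I ≤ k} : Finset (Finset α))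
      ⊆ univ.image fun f : Fin k → α ↦ univ.image f := fun I hI ↦ by
    obtain ⟨hne, hk⟩ := (mem_filter.1 hI).2
    have : Nonempty I := hne.to_subtype
    obtain ⟨e⟩ : Nonempty (I ↪ Fin k) := Function.Embedding.nonempty_of_card_le (by simpa using hk)
    refine mem_image.2 ⟨Subtype.val ∘ Function.invFun e, mem_univ _, ?_⟩
    rw [← image_image, image_univ_of_surjective (Function.invFun_surjective e.injective),
      univ_eq_attach, attach_image_val]
  simpa using (card_le_card hsub).trans card_image_le

/-- The monomials of degree at most `k`, as sets of coordinates. -/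
def lowMonomials (d k : ℕ) : Finset (Finset (Fin d)) := {I | #I ≤ k}

variable {d k : ℕ}

theorem mem_lowMonomials {I : Finset (Fin d)} : I ∈ lowMonomials d k ↔ #I ≤ k := by
  simp [lowMonomials]

theorem card_lowMonomials_erase_empty_le : #((lowMonomials d k).erase ∅) ≤ d ^ k := by
  have hfilter : (lowMonomials d k).erase ∅ =
      ({I | I.Nonempty ∧ #I ≤ k} : Finset (Finset (Fin d))) := by
    ext I
    simp [mem_lowMonomials, nonempty_iff_ne_empty]
  simpa [hfilter] using card_filter_nonempty_card_le (α := Fin d) k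

theorem card_lowMonomials_le (h : 1 ≤ d ^ k) : #(lowMonomials d k) ≤ 2 * d ^ k := by
  have := card_lowMonomials_erase_empty_le (d := d) (k := k)
  rw [card_erase_of_mem (by simp [mem_lowMonomials])] at this
  lia

/-- The monomial `x ^ I`. -/
noncomputable def monomial (I : Finset (Fin d)) (x : Cube d) : ℝ := ∏ i ∈ I, ((x i : ℤ) : ℝ)

theorem monomial_empty (x : Cube d) : monomial ∅ x = 1 := prod_empty

theorem monomial_mul (I J : Finset (Fin d)) (x : Cube d) :
    monomial I x * monomial J x = monomial (I ∆ J) x := by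
  have hite (K : Finset (Fin d)) : monomial K x = ∏ i, if i ∈ K then ((x i : ℤ) : ℝ) else 1 := by
    simp [monomial]
  simp only [hite, ← prod_mul_distrib]
  refine prod_congr rfl fun i _ ↦ ?_
  rcases Int.units_eq_one_or (x i) with h | h <;> by_cases hI : i ∈ I <;> by_cases hJ : i ∈ J <;>
    simp [h, hI, hJ, mem_symmDiff]

theorem abs_monomial (I : Finset (Fin d)) (x : Cube d) : |monomial I x| = 1 := by
  rw [monomial, abs_prod]
  refine prod_eq_one fun i _ ↦ ?_
  rcases Int.units_eq_one_or (x i) with h | h <;> simp [h]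

theorem evalAt_eq_sum_monomial (p : CubePoly d) (x : Cube d) :
    evalAt p x = ∑ I, p I * monomial I x := rfl

theorem evalAt_eq_sum_lowMonomials {p : CubePoly d} (hp : DegLE k p) (x : Cube d) :
    evalAt p x = ∑ I ∈ lowMonomials d k, p I * monomial I x := by
  refine (sum_subset (subset_univ _) fun I _ hI ↦ ?_).symm
  rw [mem_lowMonomials, not_le] at hI
  rw [hp I hI, zero_mul]

theorem abs_evalAt_le_coefNorm (p : CubePoly d) (x : Cube d) : |evalAt p x| ≤ coefNorm p := by
  rw [evalAt_eq_sum_monomial]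
  refine (abs_sum_le_sum_abs _ _).trans_eq (sum_congr rfl fun I _ ↦ ?_)
  rw [abs_mul, abs_monomial, mul_one]

/-- The polynomial functions of degree at most `k` on the cube. -/
noncomputable def lowDegree (d k : ℕ) : Submodule ℝ (Cube d → ℝ) :=
  .span ℝ (Set.range fun I : lowMonomials d k ↦ monomial I.1)

theorem evalAt_mem_lowDegree {p : CubePoly d} (hp : DegLE k p) : evalAt p ∈ lowDegree d k := by
  have hsum : evalAt p = ∑ I ∈ lowMonomials d k, p I • monomial I := by
    ext x
    simp [evalAt_eq_sum_lowMonomials hp]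
  rw [hsum]
  exact Submodule.sum_mem _ fun I hI ↦
    Submodule.smul_mem _ _ (Submodule.subset_span ⟨⟨I, hI⟩, rfl⟩)

theorem finrank_lowDegree_le : Module.finrank ℝ (lowDegree d k) ≤ #(lowMonomials d k) := by
  exact (finrank_range_le_card _).trans_eq (Fintype.card_coe _)

end Monomials

section Fourier

variable {d k : ℕ} {a : Fin d} {f g : Cube d → ℝ} {p : CubePoly d}

/-- Change of the sign of one coordinate. -/
def flipAt (a : Fin d) (x : Cube d) : Cube d := Function.update x a (-x a)

theorem flipAt_involutive (a : Fin d) : Function.Involutive (flipAt a) := fun x ↦ by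
  simp [flipAt]

theorem expect_flipAt (a : Fin d) (f : Cube d → ℝ) : 𝔼 x, f (flipAt a x) = 𝔼 x, f x :=
  Fintype.expect_equiv (flipAt_involutive a).toPerm _ _ fun _ ↦ rfl

theorem monomial_flipAt_of_notMem {I : Finset (Fin d)} (ha : a ∉ I) (x : Cube d) :
    monomial I (flipAt a x) = monomial I x :=
  prod_congr rfl fun i hi ↦ by rw [flipAt, Function.update_of_ne (ne_of_mem_of_not_mem hi ha)]

theorem monomial_insert {I : Finset (Fin d)} (ha : a ∉ I) (x : Cube d) :
    monomial (insert a I) x = ((x a : ℤ) : ℝ) * monomial I x :=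
  prod_insert ha

theorem expect_coord_mul (hf : ∀ x, f (flipAt a x) = f x) :
    𝔼 x, ((x a : ℤ) : ℝ) * f x = 0 := by
  have h := expect_flipAt a fun x ↦ ((x a : ℤ) : ℝ) * f x
  simp only [hf] at h
  simp only [flipAt, Function.update_self, Units.val_neg, Int.cast_neg, neg_mul,
    expect_neg_distrib] at h
  linarith

theorem expect_monomial (I : Finset (Fin d)) :
    𝔼 x, monomial I x = if I = ∅ then (1 : ℝ) else 0 := by
  split_ifs with hI
  · simp only [hI, monomial_empty, Fintype.expect_one]
  · obtain ⟨a, ha⟩ := nonempty_iff_ne_empty.2 hI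
    have haI := notMem_erase a I
    rw [← insert_erase ha]
    simp only [monomial_insert haI]
    exact expect_coord_mul (monomial_flipAt_of_notMem haI)

theorem expect_evalAt (p : CubePoly d) : 𝔼 x, evalAt p x = p ∅ := by
  simp only [evalAt_eq_sum_monomial, expect_sum_comm, ← mul_expect, expect_monomial]
  simp

theorem unifMean_eq_expect (p : CubePoly d) : unifMean p = 𝔼 x, evalAt p x :=
  (Fintype.expect_eq_sum_div_card _).symm

theorem expect_evalAt_sq (p : CubePoly d) : 𝔼 x, evalAt p x ^ 2 = ∑ I, p I ^ 2 := by
  have hexpand (x : Cube d) :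
      evalAt p x ^ 2 = ∑ I, ∑ J, p I * p J * monomial (I ∆ J) x := by
    simp only [evalAt_eq_sum_monomial, sq, sum_mul_sum, ← monomial_mul]
    exact sum_congr rfl fun I _ ↦ sum_congr rfl fun J _ ↦ by ring
  simp only [hexpand, expect_sum_comm, ← mul_expect, expect_monomial, ← bot_eq_empty,
    symmDiff_eq_bot]
  simp [sq]

/-- The part of a polynomial that does not involve the coordinate `a`. -/
def dropCoord (a : Fin d) (p : CubePoly d) : CubePoly d := fun I ↦ if a ∈ I then 0 else p I

/-- The derivative of a polynomial in the coordinate `a`. -/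
def coordDeriv (a : Fin d) (p : CubePoly d) : CubePoly d :=
  fun I ↦ if a ∈ I then 0 else p (insert a I)

theorem dropCoord_of_mem {I : Finset (Fin d)} (ha : a ∈ I) : dropCoord a p I = 0 := if_pos ha

theorem coordDeriv_of_mem {I : Finset (Fin d)} (ha : a ∈ I) : coordDeriv a p I = 0 := if_pos ha

theorem DegLE.dropCoord (hp : DegLE k p) : DegLE k (dropCoord a p) := fun I hI ↦ by
  simp [OutlierRemoval.dropCoord, hp I hI]

theorem DegLE.coordDeriv (hp : DegLE (k + 1) p) : DegLE k (coordDeriv a p) := fun I hI ↦ by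
  by_cases ha : a ∈ I
  · exact coordDeriv_of_mem ha
  · rw [OutlierRemoval.coordDeriv, if_neg ha, hp _ (by rw [card_insert_of_notMem ha]; lia)]

theorem subset_of_dropCoord_ne_zero {S : Finset (Fin d)} (hS : ∀ I, p I ≠ 0 → I ⊆ insert a S)
    {I : Finset (Fin d)} (hI : dropCoord a p I ≠ 0) : I ⊆ S := by
  have ha : a ∉ I := mt dropCoord_of_mem hI
  rw [dropCoord, if_neg ha] at hI
  exact (subset_insert_iff_of_notMem ha).1 (hS I hI)

theorem subset_of_coordDeriv_ne_zero {S : Finset (Fin d)} (hS : ∀ I, p I ≠ 0 → I ⊆ insert a S)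
    {I : Finset (Fin d)} (hI : coordDeriv a p I ≠ 0) : I ⊆ S := by
  have ha : a ∉ I := mt coordDeriv_of_mem hI
  rw [coordDeriv, if_neg ha] at hI
  exact (insert_subset_insert_iff ha).1 (hS _ hI)

theorem evalAt_eq_add_coord_mul (p : CubePoly d) (a : Fin d) (x : Cube d) :
    evalAt p x = evalAt (dropCoord a p) x + ((x a : ℤ) : ℝ) * evalAt (coordDeriv a p) x := by
  have hsplit (F : Finset (Fin d) → ℝ) :
      ∑ I, F I = ∑ I ∈ (univ.erase a).powerset, (F I + F (insert a I)) := by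
    rw [sum_add_distrib, ← sum_powerset_insert (notMem_erase a _), insert_erase (mem_univ a),
      powerset_univ]
  simp only [evalAt_eq_sum_monomial, mul_sum, ← sum_add_distrib]
  rw [hsplit, hsplit]
  refine sum_congr rfl fun I hI ↦ ?_
  have ha : a ∉ I := fun h ↦ notMem_erase a _ (mem_powerset.1 hI h)
  simp only [dropCoord, coordDeriv, ha, mem_insert_self, monomial_insert ha, if_true, if_false]
  ring

theorem evalAt_flipAt (hp : ∀ I, a ∈ I → p I = 0) (x : Cube d) :
    evalAt p (flipAt a x) = evalAt p x := by
  simp only [evalAt_eq_sum_monomial]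
  refine sum_congr rfl fun I _ ↦ ?_
  by_cases ha : a ∈ I
  · rw [hp I ha, zero_mul, zero_mul]
  · rw [monomial_flipAt_of_notMem ha]

theorem expect_add_coord_mul_sq (hf : ∀ x, f (flipAt a x) = f x)
    (hg : ∀ x, g (flipAt a x) = g x) :
    𝔼 x, (f x + ((x a : ℤ) : ℝ) * g x) ^ 2 = 𝔼 x, f x ^ 2 + 𝔼 x, g x ^ 2 := by
  have hexpand (x : Cube d) : (f x + ((x a : ℤ) : ℝ) * g x) ^ 2
      = f x ^ 2 + g x ^ 2 + ((x a : ℤ) : ℝ) * (2 * f x * g x) := by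
    rcases Int.units_eq_one_or (x a) with h | h <;> rw [h] <;> push_cast <;> ring
  simp only [hexpand, expect_add_distrib]
  rw [expect_coord_mul fun x ↦ by rw [hf, hg], add_zero]

theorem expect_add_coord_mul_pow_four (hf : ∀ x, f (flipAt a x) = f x)
    (hg : ∀ x, g (flipAt a x) = g x) :
    𝔼 x, (f x + ((x a : ℤ) : ℝ) * g x) ^ 4
      = 𝔼 x, f x ^ 4 + 6 * 𝔼 x, f x ^ 2 * g x ^ 2 + 𝔼 x, g x ^ 4 := by
  have hexpand (x : Cube d) : (f x + ((x a : ℤ) : ℝ) * g x) ^ 4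
      = f x ^ 4 + 6 * (f x ^ 2 * g x ^ 2) + g x ^ 4
        + ((x a : ℤ) : ℝ) * (4 * f x ^ 3 * g x + 4 * f x * g x ^ 3) := by
    rcases Int.units_eq_one_or (x a) with h | h <;> rw [h] <;> push_cast <;> ring
  simp only [hexpand, expect_add_distrib, ← mul_expect]
  rw [expect_coord_mul fun x ↦ by rw [hf, hg], add_zero]

end Fourier

section Hypercontractivity

variable {d k : ℕ} {p : CubePoly d}

theorem add_six_mul_add_le {K A B Q R X : ℝ} (hK : 0 ≤ K) (hA : 0 ≤ A) (hB : 0 ≤ B) (hR : 0 ≤ R)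
    (hQA : Q ≤ 9 * K * A ^ 2) (hRB : R ≤ K * B ^ 2) (hX : X ^ 2 ≤ Q * R) :
    Q + 6 * X + R ≤ 9 * K * (A + B) ^ 2 := by
  have hXAB : X ≤ 3 * K * A * B := by
    refine (abs_le_of_sq_le_sq' ?_ (by positivity)).2
    calc X ^ 2 ≤ Q * R := hX
      _ ≤ (9 * K * A ^ 2) * (K * B ^ 2) := mul_le_mul hQA hRB hR (by positivity)
      _ = (3 * K * A * B) ^ 2 := by ring
  have : 0 ≤ K * B ^ 2 := by positivity
  linarith

/-- Bonami's lemma, in a form that allows induction on the set of coordinates that `p` involves. -/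
theorem expect_evalAt_pow_four_le_of_subset (S : Finset (Fin d)) (hS : ∀ I, p I ≠ 0 → I ⊆ S)
    (hp : DegLE k p) :
    𝔼 x, evalAt p x ^ 4 ≤ 9 ^ k * (𝔼 x, evalAt p x ^ 2) ^ 2 := by
  induction S using Finset.induction_on generalizing k p with
  | empty =>
    have hconst (x : Cube d) : evalAt p x = p ∅ := by
      rw [evalAt_eq_sum_monomial, Fintype.sum_eq_single ∅, monomial_empty, mul_one]
      intro I hI
      rw [not_not.1 (mt (hS I) (mt subset_empty.1 hI)), zero_mul]
    simp only [hconst, Fintype.expect_const]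
    rw [← pow_mul]
    exact le_mul_of_one_le_left (by positivity) (one_le_pow₀ (by norm_num))
  | insert a S _ ih =>
    rcases k with _ | k
    · refine ih (fun I hI ↦ ?_) hp
      rw [card_eq_zero.1 (Nat.eq_zero_of_not_pos (mt (hp I) hI))]
      exact empty_subset S
    have hq := ih (fun _ ↦ subset_of_dropCoord_ne_zero hS) hp.dropCoord
    have hr := ih (fun _ ↦ subset_of_coordDeriv_ne_zero hS) hp.coordDeriv
    have hcauchy := expect_mul_sq_le_sq_mul_sq univ (fun x ↦ evalAt (dropCoord a p) x ^ 2)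
      fun x ↦ evalAt (coordDeriv a p) x ^ 2
    simp only [← pow_mul] at hcauchy
    have hq_flip := evalAt_flipAt fun I ↦ dropCoord_of_mem (p := p) (a := a) (I := I)
    have hr_flip := evalAt_flipAt fun I ↦ coordDeriv_of_mem (p := p) (a := a) (I := I)
    simp only [evalAt_eq_add_coord_mul p a]
    rw [expect_add_coord_mul_pow_four hq_flip hr_flip, expect_add_coord_mul_sq hq_flip hr_flip,
      pow_succ']
    rw [pow_succ'] at hq
    exact add_six_mul_add_le (by positivity) (expect_nonneg fun _ _ ↦ sq_nonneg _)
      (expect_nonneg fun _ _ ↦ sq_nonneg _) (expect_nonneg fun _ _ ↦ by positivity) hq hr hcauchy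

theorem expect_evalAt_pow_four_le (hp : DegLE k p) :
    𝔼 x, evalAt p x ^ 4 ≤ 9 ^ k * (𝔼 x, evalAt p x ^ 2) ^ 2 :=
  expect_evalAt_pow_four_le_of_subset univ (fun _ _ ↦ subset_univ _) hp

theorem expect_sq_le_of_expect_pow_four_le {X : Type*} [Fintype X] {f : X → ℝ} {K : ℝ}
    (hK : 0 ≤ K) (hf : ∀ x, 0 ≤ f x) (h : 𝔼 x, f x ^ 4 ≤ K * (𝔼 x, f x ^ 2) ^ 2) :
    𝔼 x, f x ^ 2 ≤ K * (𝔼 x, f x) ^ 2 := by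
  have hone_three : (𝔼 x, f x ^ 2) ^ 2 ≤ (𝔼 x, f x) * 𝔼 x, f x ^ 3 := by
    have := expect_mul_sq_le_sq_mul_sq univ (fun x ↦ √(f x)) fun x ↦ √(f x ^ 3)
    have hsqrt (x : X) : √(f x) * √(f x ^ 3) = f x ^ 2 := by
      rw [← Real.sqrt_mul (hf x), ← pow_succ', show 3 + 1 = 2 * 2 by rfl, pow_mul,
        Real.sqrt_sq (sq_nonneg _)]
    simpa only [hsqrt, Real.sq_sqrt (hf _), Real.sq_sqrt (pow_nonneg (hf _) 3)] using this
  have htwo_four : (𝔼 x, f x ^ 3) ^ 2 ≤ (𝔼 x, f x ^ 2) * 𝔼 x, f x ^ 4 := by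
    have hcube (x : X) : f x ^ 3 = f x * f x ^ 2 := pow_succ' _ _
    have hfourth (x : X) : f x ^ 4 = (f x ^ 2) ^ 2 := pow_mul _ 2 2
    simpa only [hcube, hfourth] using expect_mul_sq_le_sq_mul_sq univ f fun x ↦ f x ^ 2
  have hE : 0 ≤ 𝔼 x, f x ^ 2 := expect_nonneg fun _ _ ↦ sq_nonneg _
  generalize 𝔼 x, f x ^ 2 = A at *
  rcases hE.eq_or_lt with rfl | hA
  · positivity
  refine le_of_mul_le_mul_left ?_ (pow_pos hA 3)
  calc A ^ 3 * A = (A ^ 2) ^ 2 := by ring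
    _ ≤ ((𝔼 x, f x) * 𝔼 x, f x ^ 3) ^ 2 := by gcongr
    _ = (𝔼 x, f x) ^ 2 * (𝔼 x, f x ^ 3) ^ 2 := mul_pow _ _ _
    _ ≤ (𝔼 x, f x) ^ 2 * (A * (K * A ^ 2)) := by
        gcongr
        exact htwo_four.trans (by gcongr)
    _ = A ^ 3 * (K * (𝔼 x, f x) ^ 2) := by ring

theorem coefNorm_sq_le (hp : DegLE k p) (h0 : ∀ x, 0 ≤ evalAt p x) :
    coefNorm p ^ 2 ≤ #(lowMonomials d k) * (9 ^ k * unifMean p ^ 2) := by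
  have hlow : coefNorm p = ∑ I ∈ lowMonomials d k, |p I| := by
    refine (sum_subset (subset_univ _) fun I _ hI ↦ ?_).symm
    rw [mem_lowMonomials, not_le] at hI
    rw [hp I hI, abs_zero]
  calc coefNorm p ^ 2 ≤ #(lowMonomials d k) * ∑ I ∈ lowMonomials d k, |p I| ^ 2 :=
        hlow ▸ sq_sum_le_card_mul_sum_sq
    _ ≤ #(lowMonomials d k) * ∑ I, p I ^ 2 := by
        simp only [sq_abs]
        gcongr
        exact subset_univ _
    _ ≤ #(lowMonomials d k) * (9 ^ k * unifMean p ^ 2) := by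
        rw [← expect_evalAt_sq, unifMean_eq_expect]
        gcongr
        exact expect_sq_le_of_expect_pow_four_le (by positivity) h0 (expect_evalAt_pow_four_le hp)

end Hypercontractivity

section Balanced

variable {N d k : ℕ} {β : ℝ}

/-- A sample on which every non-constant monomial of degree at most `k` has an average of absolute
value at most `β`; its average over the whole cube vanishes. -/
def IsBalanced (k : ℕ) (β : ℝ) (y : Sample N d) : Prop :=
  ∀ I ∈ (lowMonomials d k).erase ∅, |∑ i, monomial I (y i)| ≤ N * β

theorem unifProb_lt_abs_sum_monomial_le {I : Finset (Fin d)} (hI : I ≠ ∅) (hβ : 0 ≤ β) :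
    unifProb (fun y : Sample N d ↦ N * β < |∑ i, monomial I (y i)|)
      ≤ 2 * Real.exp (-(N * β ^ 2 / 2)) := by
  have hmean : 𝔼 x, monomial I x = 0 := by rw [expect_monomial, if_neg hI]
  have hexp : (N * β) ^ 2 / (2 * N) = N * β ^ 2 / 2 := by
    rcases eq_or_ne (N : ℝ) 0 with hN | hN
    · simp [hN]
    · field_simp
  have hupper := unifProb_lt_sum_le_exp (fun (_ : Fin N) ↦ monomial I) (fun _ ↦ 1)
    (fun _ x ↦ (abs_monomial I x).le) (fun _ ↦ hmean) (w := N) (t := N * β)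
    (by positivity) (by positivity) (by simp)
  have hlower := unifProb_lt_sum_le_exp (fun (_ : Fin N) x ↦ -monomial I x) (fun _ ↦ 1)
    (fun _ x ↦ by rw [abs_neg, abs_monomial]) (fun _ ↦ by rw [expect_neg_distrib, hmean, neg_zero])
    (w := N) (t := N * β) (by positivity) (by positivity) (by simp)
  simp only [sum_neg_distrib, hexp] at hupper hlower
  simp only [lt_abs, two_mul]
  exact unifProb_or_le.trans (add_le_add hupper hlower)

theorem unifProb_not_isBalanced_le (hβ : 0 ≤ β) :
    unifProb (fun y : Sample N d ↦ ¬ IsBalanced k β y)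
      ≤ 2 * d ^ k * Real.exp (-(N * β ^ 2 / 2)) := by
  simp only [IsBalanced, not_forall, not_le, exists_prop]
  calc _ ≤ ∑ I ∈ (lowMonomials d k).erase ∅, 2 * Real.exp (-(N * β ^ 2 / 2)) :=
        (unifProb_exists_mem_le _ _).trans (sum_le_sum fun I hI ↦
          unifProb_lt_abs_sum_monomial_le (ne_of_mem_erase hI) hβ)
    _ = #((lowMonomials d k).erase ∅) * (2 * Real.exp (-(N * β ^ 2 / 2))) := by
        rw [sum_const, nsmul_eq_mul]
    _ ≤ (d : ℝ) ^ k * (2 * Real.exp (-(N * β ^ 2 / 2))) := by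
        gcongr
        exact_mod_cast card_lowMonomials_erase_empty_le
    _ = _ := by ring

theorem IsBalanced.sum_evalAt_le {p : CubePoly d} {y : Sample N d} (hy : IsBalanced k β y)
    (hp : DegLE k p) (hβ : 0 ≤ β) :
    ∑ i, evalAt p (y i) ≤ N * (unifMean p + coefNorm p * β) := by
  have hconst : ∑ i, p ∅ * monomial ∅ (y i) = N * unifMean p := by
    simp [monomial_empty, unifMean_eq_expect, expect_evalAt]
  simp only [evalAt_eq_sum_lowMonomials hp]
  rw [sum_comm, ← add_sum_erase _ _ (mem_lowMonomials.2 (by simp) : ∅ ∈ lowMonomials d k), hconst,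
    mul_add]
  gcongr
  calc ∑ I ∈ (lowMonomials d k).erase ∅, ∑ i, p I * monomial I (y i)
      ≤ ∑ I ∈ (lowMonomials d k).erase ∅, |p I| * (N * β) := by
        refine sum_le_sum fun I hI ↦ ?_
        rw [← mul_sum]
        refine (le_abs_self _).trans ?_
        rw [abs_mul]
        exact mul_le_mul_of_nonneg_left (hy I hI) (abs_nonneg _)
    _ ≤ ∑ I, |p I| * (N * β) :=
        sum_le_sum_of_subset_of_nonneg (subset_univ _) fun _ _ _ ↦ by positivity
    _ = N * (coefNorm p * β) := by rw [← sum_mul, coefNorm]; ring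

end Balanced

section LinearProgram

variable {N d k : ℕ} {ε : ℝ} {ref inp : Sample N d} {p : CubePoly d}

theorem coefBound_nonneg (d k : ℕ) : 0 ≤ coefBound d k := by
  unfold coefBound
  positivity

theorem coefBound_sq (d k : ℕ) : coefBound d k ^ 2 = 9 ^ k * (d : ℝ) ^ k := by
  unfold coefBound
  rw [mul_pow, ← pow_mul, mul_comm k 2, pow_mul, ← Real.rpow_natCast ((d : ℝ) ^ ((k : ℝ) / 2)),
    ← Real.rpow_mul (by positivity)]
  norm_num

theorem coefBound_pos (h : 1 ≤ d ^ k) : 0 < coefBound d k := by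
  have hdk : (0 : ℝ) < (d : ℝ) ^ k := by exact_mod_cast h
  have hsq : 0 < coefBound d k ^ 2 := by
    rw [coefBound_sq]
    positivity
  exact (coefBound_nonneg d k).lt_of_ne' (sq_pos_iff.1 hsq)

theorem slack_nonneg (d k : ℕ) (hε : 0 ≤ ε) : 0 ≤ slack d k ε := by
  have := coefBound_nonneg d k
  unfold slack
  positivity

theorem slack_mul_coefBound_le (d k : ℕ) (hε : 0 ≤ ε) : slack d k ε * coefBound d k ≤ ε / 2 := by
  rw [slack, div_mul_eq_mul_div, mul_div_mul_comm]
  exact mul_le_of_le_one_right (by positivity) (div_self_le_one _)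

theorem continuous_evalAt (x : Cube d) : Continuous fun p : CubePoly d ↦ evalAt p x := by
  unfold evalAt
  fun_prop

theorem continuous_coefNorm : Continuous (coefNorm : CubePoly d → ℝ) := by
  unfold coefNorm
  fun_prop

theorem IsFeasible.evalAt_le (hp : IsFeasible k ε ref inp p) (x : Cube d) :
    evalAt p x ≤ coefBound d k :=
  (le_abs_self _).trans ((abs_evalAt_le_coefNorm p x).trans hp.2.1)

theorem isFeasible_zero (hε : 0 ≤ ε) (ref inp : Sample N d) : IsFeasible k ε ref inp 0 := by
  have heval (x : Cube d) : evalAt 0 x = 0 := by simp [evalAt]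
  refine ⟨fun I _ ↦ rfl, ?_, fun i ↦ (heval _).ge, fun i ↦ (heval _).ge, ?_⟩
  · simpa [coefNorm] using coefBound_nonneg d k
  · simp only [heval, sum_const_zero, mul_zero]
    positivity

theorem isClosed_setOf_isFeasible (ref inp : Sample N d) :
    IsClosed {p : CubePoly d | IsFeasible k ε ref inp p} := by
  simp only [IsFeasible, DegLE, Set.ofPred_and, Set.ofPred_forall]
  exact (isClosed_iInter fun I ↦ isClosed_iInter fun _ ↦
      isClosed_eq (continuous_apply I) continuous_const).inter
    ((isClosed_le continuous_coefNorm continuous_const).inter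
    ((isClosed_iInter fun i ↦ isClosed_le continuous_const (continuous_evalAt _)).inter
    ((isClosed_iInter fun i ↦ isClosed_le continuous_const (continuous_evalAt _)).inter
    (isClosed_le (continuous_const.mul (continuous_finsetSum _ fun i _ ↦ continuous_evalAt _))
      continuous_const))))

theorem isCompact_setOf_isFeasible (ref inp : Sample N d) :
    IsCompact {p : CubePoly d | IsFeasible k ε ref inp p} := by
  refine Metric.isCompact_of_isClosed_isBounded (isClosed_setOf_isFeasible ref inp)
    ((Metric.isBounded_closedBall (x := (0 : CubePoly d)) (r := coefBound d k)).subset ?_)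
  intro p hp
  rw [mem_closedBall_zero_iff, pi_norm_le_iff_of_nonneg (coefBound_nonneg d k)]
  intro I
  rw [Real.norm_eq_abs]
  exact (single_le_sum (f := fun I ↦ |p I|) (fun I _ ↦ abs_nonneg _) (mem_univ I)).trans hp.2.1

theorem exists_isSolution (hε : 0 ≤ ε) (ref inp : Sample N d) (S : Finset (Fin N)) :
    ∃ p, IsSolution k ε ref inp S p := by
  obtain ⟨p, hp, hmax⟩ := (isCompact_setOf_isFeasible (k := k) (ε := ε) ref inp).exists_isMaxOn
    ⟨0, isFeasible_zero hε ref inp⟩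
    (continuous_finsetSum S fun i _ ↦ continuous_evalAt (inp i)).continuousOn
  exact ⟨p, hp, fun q hq ↦ hmax hq⟩

theorem pos_of_lt_score {S : Finset (Fin N)} (hε : 0 ≤ ε) (h : ε < score inp S p) :
    0 < N ∧ S.Nonempty := by
  refine ⟨Nat.pos_of_ne_zero ?_, nonempty_iff_ne_empty.2 ?_⟩ <;> rintro rfl <;>
    simp only [score, Nat.cast_zero, div_zero, zero_mul, sum_empty, mul_zero] at h <;> linarith

theorem IsFeasible.slack_pos {S : Finset (Fin N)} (hp : IsFeasible k ε ref inp p) (hε : 0 < ε)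
    (h : ε < score inp S p) : 0 < slack d k ε := by
  have hB : 0 < coefBound d k := by
    by_contra! hB
    have hscore : score inp S p ≤ 0 := mul_nonpos_of_nonneg_of_nonpos (by positivity)
      (sum_nonpos fun i _ ↦ (hp.evalAt_le _).trans hB)
    linarith
  unfold slack
  positivity

end LinearProgram

section TailSets

open Filter Topology

variable {ι κ : Type*} {f : ι → ℝ} {g : κ → ℝ} {S : Finset ι} {T : Finset κ} {τ B : ℝ}

/-- The indices in `S` at which `f` exceeds `τ`. -/
noncomputable def tailSet (S : Finset ι) (f : ι → ℝ) (τ : ℝ) : Finset ι := {i ∈ S | τ < f i}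

theorem mem_tailSet {i : ι} : i ∈ tailSet S f τ ↔ i ∈ S ∧ τ < f i := mem_filter

theorem tailSet_subset : tailSet S f τ ⊆ S := filter_subset _ _

theorem antitone_card_tailSet (S : Finset ι) (f : ι → ℝ) :
    Antitone fun t ↦ (#(tailSet S f t) : ℝ) := fun s t hst ↦ by
  refine Nat.cast_le.2 (card_le_card fun i hi ↦ ?_)
  rw [mem_tailSet] at hi ⊢
  exact ⟨hi.1, hst.trans_lt hi.2⟩

theorem integral_ite_lt {v : ℝ} (h0 : 0 ≤ v) (hB : v ≤ B) :
    ∫ t in (0 : ℝ)..B, (if t < v then (1 : ℝ) else 0) = v := by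
  have hind : (fun t : ℝ ↦ if t < v then (1 : ℝ) else 0) = (Set.Iio v).indicator 1 := by
    ext t
    simp [Set.indicator]
  have hinter : Set.Ioc 0 B ∩ Set.Iio v = Set.Ioo 0 v := by
    ext t
    exact ⟨fun h ↦ ⟨h.1.1, h.2⟩, fun h ↦ ⟨⟨h.1, h.2.le.trans hB⟩, h.2⟩⟩
  rw [hind, intervalIntegral.integral_of_le (h0.trans hB),
    MeasureTheory.setIntegral_indicator measurableSet_Iio, hinter]
  simp [h0]

theorem integral_card_tailSet (hf : ∀ i ∈ S, f i ∈ Set.Icc 0 B) :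
    ∫ t in (0 : ℝ)..B, (#(tailSet S f t) : ℝ) = ∑ i ∈ S, f i := by
  have hsum (t : ℝ) : (#(tailSet S f t) : ℝ) = ∑ i ∈ S, if t < f i then (1 : ℝ) else 0 := by
    simp [tailSet]
  have hint (v : ℝ) : IntervalIntegrable (fun t : ℝ ↦ if t < v then (1 : ℝ) else 0)
      MeasureTheory.volume 0 B := by
    refine Antitone.intervalIntegrable fun s t hst ↦ ?_
    by_cases ht : t < v
    · simp [ht, hst.trans_lt ht]
    · simp only [ht, if_false]
      positivity
  simp only [hsum]
  rw [intervalIntegral.integral_finsetSum fun i _ ↦ hint _]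
  exact sum_congr rfl fun i hi ↦ integral_ite_lt (hf i hi).1 (hf i hi).2

theorem exists_mul_card_tailSet_add_le {a c : ℝ} (hB : 0 ≤ B) (hf : ∀ i ∈ S, f i ∈ Set.Icc 0 B)
    (hg : ∀ j ∈ T, g j ∈ Set.Icc 0 B) (h : a * ∑ j ∈ T, g j + c * B < ∑ i ∈ S, f i) :
    ∃ t, 0 ≤ t ∧ a * #(tailSet T g t) + c ≤ #(tailSet S f t) := by
  by_contra! hlt
  have hintf := (antitone_card_tailSet S f).intervalIntegrable (μ := MeasureTheory.volume)
    (a := 0) (b := B)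
  have hintg := ((antitone_card_tailSet T g).intervalIntegrable (μ := MeasureTheory.volume)
    (a := 0) (b := B)).const_mul a
  have hle := intervalIntegral.integral_mono_on hB hintf (hintg.add intervalIntegrable_const)
    fun t ht ↦ (hlt t ht.1).le
  rw [intervalIntegral.integral_add hintg intervalIntegrable_const,
    intervalIntegral.integral_const_mul, integral_card_tailSet hf, integral_card_tailSet hg,
    intervalIntegral.integral_const, smul_eq_mul, sub_zero, mul_comm B] at hle
  exact hle.not_gt h

theorem eventually_tailSet_eq (S : Finset ι) (f : ι → ℝ) (τ : ℝ) :
    ∀ᶠ s in 𝓝[≥] τ, tailSet S f s = tailSet S f τ := by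
  have hlt : ∀ᶠ s in 𝓝[≥] τ, ∀ i ∈ tailSet S f τ, s < f i :=
    (eventually_all_finset _).2 fun i hi ↦
      nhdsWithin_le_nhds (eventually_lt_nhds (mem_tailSet.1 hi).2)
  filter_upwards [hlt, self_mem_nhdsWithin] with s hs hτs
  ext i
  exact ⟨fun hi ↦ mem_tailSet.2 ⟨(mem_tailSet.1 hi).1, hτs.trans_lt (mem_tailSet.1 hi).2⟩,
    fun hi ↦ mem_tailSet.2 ⟨(mem_tailSet.1 hi).1, hs i hi⟩⟩

theorem exists_isLeast_of_eventually {Q : ℝ → Prop} (hne : ∃ t, 0 ≤ t ∧ Q t)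
    (hQ : ∀ τ, ∀ᶠ s in 𝓝[≥] τ, Q s → Q τ) : ∃ τ, IsLeast {t | 0 ≤ t ∧ Q t} τ := by
  have hglb := isGLB_csInf hne ⟨0, fun t ht ↦ ht.1⟩
  obtain ⟨s, hs, hsQ⟩ := ((hglb.frequently_mem hne).and_eventually (hQ _)).exists
  exact ⟨_, ⟨le_csInf hne fun t ht ↦ ht.1, hsQ hs.2⟩, hglb.1⟩

end TailSets

section Threshold

variable {N d k : ℕ} {ε τ : ℝ} {ref inp smp : Sample N d} {S : Finset (Fin N)} {p : CubePoly d}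

theorem card_div_mul_tailProb (smp : Sample N d) (S : Finset (Fin N)) (p : CubePoly d) (τ : ℝ) :
    (#S : ℝ) / N * tailProb smp S p τ = #(tailSet S (fun i ↦ evalAt p (smp i)) τ) / (N : ℝ) := by
  rcases S.eq_empty_or_nonempty with rfl | hS
  · simp [tailSet]
  · have hcard : (#S : ℝ) ≠ 0 := by exact_mod_cast hS.card_pos.ne'
    rw [tailProb, div_mul_div_comm, mul_comm (N : ℝ), mul_div_mul_left _ _ hcard]
    rfl

theorem isThreshold_iff (hN : 0 < N) : IsThreshold k ε ref inp S p τ ↔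
    IsLeast {t | 0 ≤ t ∧ 2 * #(tailSet univ (fun i ↦ evalAt p (ref i)) t) + N * slack d k ε
      ≤ (#(tailSet S (fun i ↦ evalAt p (inp i)) t) : ℝ)} τ := by
  have hN' : (N : ℝ) ≠ 0 := by positivity
  have hiff (t : ℝ) : 2 * tailProb ref univ p t + slack d k ε ≤ #S / N * tailProb inp S p t ↔
      2 * #(tailSet univ (fun i ↦ evalAt p (ref i)) t) + N * slack d k ε
        ≤ (#(tailSet S (fun i ↦ evalAt p (inp i)) t) : ℝ) := by
    have href := card_div_mul_tailProb ref univ p t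
    rw [card_univ, Fintype.card_fin, div_self hN', one_mul] at href
    rw [card_div_mul_tailProb, href, le_div_iff₀ (by positivity)]
    field_simp
  simp only [IsThreshold, hiff]

/-- If no threshold were admissible, integrating the reverse inequality over `[0, B]` would bound
the score by `2 * (ε / 4) + Δ * B ≤ ε`. -/
theorem IsFeasible.exists_isThreshold (hp : IsFeasible k ε ref inp p) (hε : 0 < ε)
    (h : ε < score inp S p) : ∃ τ, IsThreshold k ε ref inp S p τ := by
  have hN := (pos_of_lt_score hε.le h).1
  have hN' : (0 : ℝ) < N := by exact_mod_cast hN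
  simp only [isThreshold_iff hN]
  refine exists_isLeast_of_eventually (exists_mul_card_tailSet_add_le (coefBound_nonneg d k)
    (fun i _ ↦ ⟨hp.2.2.2.1 i, hp.evalAt_le _⟩) (fun i _ ↦ ⟨hp.2.2.1 i, hp.evalAt_le _⟩) ?_)
    fun τ ↦ ?_
  · have hmean := hp.2.2.2.2
    rw [score, one_div, lt_inv_mul_iff₀ hN'] at h
    rw [one_div, inv_mul_le_iff₀ hN'] at hmean
    calc _ ≤ 2 * (N * (ε / 4)) + N * (ε / 2) := by
          rw [mul_assoc (N : ℝ)]
          gcongr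
          exact slack_mul_coefBound_le d k hε.le
      _ = N * ε := by ring
      _ < _ := h
  · filter_upwards [eventually_tailSet_eq univ (fun i ↦ evalAt p (ref i)) τ,
      eventually_tailSet_eq S (fun i ↦ evalAt p (inp i)) τ] with s href hinp hs
    rwa [href, hinp] at hs

theorem Reaches.add_card_le (hε : 0 < ε) {i : ℕ} (h : Reaches k ε ref inp i S) : i + #S ≤ N := by
  induction h with
  | start => simp
  | @step i S p τ _ hsol hscore hτ ih =>
    have hN := (pos_of_lt_score hε.le hscore).1
    have hslack := hsol.1.slack_pos hε hscore
    have hle := ((isThreshold_iff hN).1 hτ).1.2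
    have hpos : (0 : ℝ) < #(tailSet S (fun i ↦ evalAt p (inp i)) τ) :=
      lt_of_lt_of_le (by positivity) hle
    rw [Nat.cast_pos] at hpos
    change i + 1 + #(S \ tailSet S (fun i ↦ evalAt p (inp i)) τ) ≤ N
    have := card_sdiff_add_card_eq_card (tailSet_subset (S := S) (f := fun i ↦ evalAt p (inp i))
      (τ := τ))
    lia

theorem alwaysOutputs (k : ℕ) (hε : 0 < ε) (ref inp : Sample N d) :
    AlwaysOutputs k ε ref inp := by
  refine fun i S hS ↦ ⟨exists_isSolution hε.le ref inp S, fun p hp hscore ↦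
    ⟨?_, hp.1.exists_isThreshold hε hscore⟩⟩
  have hcard := hS.add_card_le hε
  have := (pos_of_lt_score hε.le hscore).2.card_pos
  lia

end Threshold

section Outlier

variable {N d k : ℕ} {ε η α M : ℝ} {cln ref inp : Sample N d} {R S T : Finset (Fin N)}
  {p : CubePoly d}

/-- Every tail event of every polynomial of degree at most `k` is more frequent in the sample `cln`
than in the sample `ref` by at most `α`. -/
def TailsLE (k : ℕ) (α : ℝ) (cln ref : Sample N d) : Prop :=
  ∀ p, DegLE k p → ∀ τ, (#(tailSet univ (fun i ↦ evalAt p (cln i)) τ) : ℝ)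
    ≤ #(tailSet univ (fun i ↦ evalAt p (ref i)) τ) + N * α

theorem tailSet_evalAt_mem_posSets (hp : DegLE k p) (τ : ℝ) :
    tailSet univ (evalAt p) τ ∈ posSets (lowDegree d k) := by
  have hconst : (fun _ ↦ τ) ∈ lowDegree d k := by
    have hone : monomial ∅ ∈ lowDegree d k :=
      Submodule.subset_span ⟨⟨∅, mem_lowMonomials.2 (by simp)⟩, rfl⟩
    convert Submodule.smul_mem _ τ hone using 1
    ext x
    simp [monomial_empty]
  refine mem_posSets.2 ⟨_, sub_mem (evalAt_mem_lowDegree hp) hconst, fun x ↦ ?_⟩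
  simp [mem_tailSet]

theorem unifProb_not_tailsLE_le (hdk : 1 ≤ d ^ k) (hα : 0 ≤ α) (hM : 1 ≤ M)
    (hN : 1024 * (2 * d ^ k * M) ≤ N * (α / 2) ^ 2) :
    unifProb (fun ω : Sample N d × Sample N d ↦ ¬ TailsLE k α ω.1 ω.2) ≤ 2 * Real.exp (-M) := by
  have hvc : (posSets (lowDegree d k)).vcDim ≤ 2 * d ^ k :=
    vcDim_posSets_le.trans (finrank_lowDegree_le.trans (card_lowMonomials_le hdk))
  have hV : 1 ≤ 2 * d ^ k := by lia
  refine (unifProb_mono ?_).trans (unifProb_exists_card_pullback_lt_le hvc hα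
    (by exact_mod_cast hV) hM (by simpa using hN))
  intro ω hω
  simp only [TailsLE, not_forall, not_le] at hω
  obtain ⟨p, hp, τ, hlt⟩ := hω
  have htail (y : Sample N d) : pullback y (tailSet univ (evalAt p) τ)
      = tailSet univ (fun i ↦ evalAt p (y i)) τ := by
    ext i
    simp [mem_pullback, mem_tailSet]
  refine ⟨_, tailSet_evalAt_mem_posSets hp τ, ?_⟩
  rwa [htail, htail, Fintype.card_fin]

theorem card_sdiff_sdiff_of_subset {ι : Type*} [DecidableEq ι] {Q S D : Finset ι} (h : D ⊆ S) :
    #(Q \ (S \ D)) = #(Q \ S) + #(Q ∩ D) := by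
  rw [sdiff_sdiff_right', sup_eq_union, inf_eq_inter, card_union_of_disjoint]
  exact disjoint_sdiff_self_left.mono_right (inter_subset_right.trans h)

/-- A filtering step removes at least twice as many examples as the tail event of the reference
sample accounts for, plus `N Δ`, hence at least twice as many as there are clean ones. -/
theorem TailsLE.two_mul_card_inter_le (h : TailsLE k (slack d k ε / 2) cln ref)
    (hcont : IsContamination η cln R inp) (hN : 0 < N) (hp : DegLE k p) {τ : ℝ}
    (hτ : IsThreshold k ε ref inp S p τ) :
    2 * #(Rᶜ ∩ tailSet S (fun i ↦ evalAt p (inp i)) τ)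
      ≤ #(tailSet S (fun i ↦ evalAt p (inp i)) τ) := by
  have hclean : Rᶜ ∩ tailSet S (fun i ↦ evalAt p (inp i)) τ
      ⊆ tailSet univ (fun i ↦ evalAt p (cln i)) τ := fun j hj ↦ by
    rw [mem_inter, mem_compl, mem_tailSet] at hj
    rw [mem_tailSet, ← hcont.2 j hj.1]
    exact ⟨mem_univ _, hj.2.2⟩
  have hle := ((isThreshold_iff hN).1 hτ).1.2
  have htail := h p hp τ
  have hcard : (#(Rᶜ ∩ tailSet S (fun i ↦ evalAt p (inp i)) τ) : ℝ)
      ≤ #(tailSet univ (fun i ↦ evalAt p (cln i)) τ) := by exact_mod_cast card_le_card hclean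
  have : (2 : ℝ) * #(Rᶜ ∩ tailSet S (fun i ↦ evalAt p (inp i)) τ)
      ≤ #(tailSet S (fun i ↦ evalAt p (inp i)) τ) := by linarith
  exact_mod_cast this

theorem Reaches.card_compl_sdiff_le (hε : 0 ≤ ε) (h : TailsLE k (slack d k ε / 2) cln ref)
    (hcont : IsContamination η cln R inp) {i : ℕ} (hS : Reaches k ε ref inp i S) :
    #(Rᶜ \ S) ≤ #(R \ S) := by
  induction hS with
  | start => exact card_le_card fun j hj ↦ absurd (mem_univ j) (mem_sdiff.1 hj).2
  | @step _ S p τ _ hsol hscore hτ ih =>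
    change #(Rᶜ \ (S \ tailSet S (fun i ↦ evalAt p (inp i)) τ))
      ≤ #(R \ (S \ tailSet S (fun i ↦ evalAt p (inp i)) τ))
    have htwo := h.two_mul_card_inter_le hcont (pos_of_lt_score hε hscore).1 hsol.1.1 hτ
    have hsplit := card_inter_add_card_sdiff (tailSet S (fun i ↦ evalAt p (inp i)) τ) R
    rw [sdiff_eq_inter_compl, inter_comm, inter_comm _ Rᶜ] at hsplit
    rw [card_sdiff_sdiff_of_subset tailSet_subset, card_sdiff_sdiff_of_subset tailSet_subset]
    lia

theorem IsOutput.sum_evalAt_le (hT : IsOutput k ε ref inp T)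
    (hp : IsFeasible k ε ref inp p) : ∑ i ∈ T, evalAt p (inp i) ≤ ε * N := by
  rcases N.eq_zero_or_pos with rfl | hN
  · simp [eq_empty_of_isEmpty T]
  obtain ⟨-, -, -, q, hq, hscore⟩ := hT
  rw [score, one_div, inv_mul_le_iff₀ (by positivity), mul_comm] at hscore
  exact (hq.2 p hp).trans hscore

theorem coefNorm_le_coefBound_mul (hdk : 1 ≤ d ^ k) (hε : 0 ≤ ε) (hp : DegLE k p)
    (h0 : ∀ x, 0 ≤ evalAt p x) (hmean : unifMean p ≤ ε / 8) :
    coefNorm p ≤ coefBound d k * (ε / 4) := by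
  have hB := coefBound_nonneg d k
  have hmean0 : 0 ≤ unifMean p := by
    rw [unifMean_eq_expect]
    exact expect_nonneg fun x _ ↦ h0 x
  have hcard : (#(lowMonomials d k) : ℝ) ≤ 2 * (d : ℝ) ^ k := by
    exact_mod_cast card_lowMonomials_le hdk
  refine (abs_le_of_sq_le_sq' ?_ (by positivity)).2
  calc coefNorm p ^ 2 ≤ #(lowMonomials d k) * (9 ^ k * unifMean p ^ 2) := coefNorm_sq_le hp h0
    _ ≤ (2 * (d : ℝ) ^ k) * (9 ^ k * (ε / 8) ^ 2) := by gcongr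
    _ = coefBound d k ^ 2 * (ε ^ 2 / 32) := by rw [coefBound_sq]; ring
    _ ≤ coefBound d k ^ 2 * (ε / 4) ^ 2 := by
        gcongr
        linarith [sq_nonneg ε]
    _ = (coefBound d k * (ε / 4)) ^ 2 := (mul_pow _ _ _).symm

theorem IsBalanced.isFeasible (href : IsBalanced k (1 / (2 * coefBound d k)) ref)
    (hdk : 1 ≤ d ^ k) (hε : 0 ≤ ε) (hε1 : ε ≤ 1) (hp : DegLE k p) (h0 : ∀ x, 0 ≤ evalAt p x)
    (hmean : unifMean p ≤ ε / 8) : IsFeasible k ε ref inp p := by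
  have hB := coefBound_pos hdk
  have hcoef := coefNorm_le_coefBound_mul hdk hε hp h0 hmean
  refine ⟨hp, hcoef.trans (mul_le_of_le_one_right hB.le (by linarith)), fun _ ↦ h0 _,
    fun _ ↦ h0 _, ?_⟩
  rw [one_div_mul_eq_div]
  refine div_le_of_le_mul₀ (Nat.cast_nonneg _) (by positivity) ?_
  calc ∑ i, evalAt p (ref i)
      ≤ N * (unifMean p + coefNorm p * (1 / (2 * coefBound d k))) :=
        href.sum_evalAt_le hp (by positivity)
    _ ≤ N * (ε / 8 + coefBound d k * (ε / 4) * (1 / (2 * coefBound d k))) := by gcongr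
    _ = ε / 4 * N := by
        field_simp
        ring

theorem evalAt_eq_unifMean (p : CubePoly 0) (x : Cube 0) : evalAt p x = unifMean p := by
  have hconst (y : Cube 0) : evalAt p y = evalAt p x := by rw [Subsingleton.elim y x]
  rw [unifMean_eq_expect]
  simp only [hconst, Fintype.expect_const]

/-- For `d = 0 < k` the coefficient bound `B` vanishes, so that feasibility is of no use; but then
the cube is a single point. -/
theorem IsBalanced.sum_evalAt_le_of_isOutput (href : IsBalanced k (1 / (2 * coefBound d k)) ref)
    (hε : 0 ≤ ε) (hε1 : ε ≤ 1) (hT : IsOutput k ε ref inp T) (hp : DegLE k p)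
    (h0 : ∀ x, 0 ≤ evalAt p x) (hmean : unifMean p ≤ ε / 8) :
    ∑ i ∈ T, evalAt p (inp i) ≤ ε * N := by
  rcases Nat.eq_zero_or_pos (d ^ k) with hdk | hdk
  · obtain rfl : d = 0 := eq_zero_of_pow_eq_zero hdk
    calc ∑ i ∈ T, evalAt p (inp i) ≤ ∑ i, evalAt p (inp i) :=
          sum_le_sum_of_subset_of_nonneg (subset_univ T) fun _ _ _ ↦ h0 _
      _ = N * unifMean p := by simp [evalAt_eq_unifMean]
      _ ≤ N * ε := by gcongr; linarith
      _ = ε * N := mul_comm _ _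
  · exact hT.sum_evalAt_le (href.isFeasible hdk hε hε1 hp h0 hmean)

end Outlier

section SampleSize

variable {N d k : ℕ} {ε δ M : ℝ}

theorem three_mul_pow_two_mul (d k : ℕ) :
    (3 * (d : ℝ)) ^ (2 * k) = coefBound d k ^ 2 * (d : ℝ) ^ k := by
  rw [coefBound_sq, mul_pow, pow_mul 3, mul_comm 2 k, pow_mul (d : ℝ)]
  norm_num
  ring

theorem two_mul_exp_neg_two_mul_le (hM : 1 ≤ M) :
    2 * Real.exp (-(2 * M)) ≤ Real.exp (-M) := by
  have htwo : 2 ≤ Real.exp M := by linarith [Real.add_one_le_exp M]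
  calc 2 * Real.exp (-(2 * M)) ≤ Real.exp M * Real.exp (-(2 * M)) := by gcongr
    _ = Real.exp (-M) := by rw [← Real.exp_add]; ring_nf

theorem exp_neg_max_le (hδ : 0 < δ) : Real.exp (-max 1 (Real.log (1 / δ))) ≤ δ := by
  calc Real.exp (-max 1 (Real.log (1 / δ))) ≤ Real.exp (-Real.log (1 / δ)) := by
        gcongr
        exact le_max_right _ _
    _ = δ := by rw [one_div, Real.log_inv, neg_neg, Real.exp_log hδ]

theorem unifProb_not_tailsLE_slack_le (hε : 0 < ε) (hM : 1 ≤ M)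
    (hN : 2 ^ 18 * ((3 * (d : ℝ)) ^ (2 * k) / ε ^ 2) * M ≤ N) :
    unifProb (fun ω : Sample N d × Sample N d ↦ ¬ TailsLE k (slack d k ε / 2) ω.1 ω.2)
      ≤ Real.exp (-M) := by
  have hslack := slack_nonneg d k hε.le
  rcases Nat.eq_zero_or_pos (d ^ k) with hdk | hdk
  · obtain rfl : d = 0 := eq_zero_of_pow_eq_zero hdk
    have htails (ω : Sample N 0 × Sample N 0) : TailsLE k (slack 0 k ε / 2) ω.1 ω.2 :=
      fun p _ τ ↦ by
        rw [Subsingleton.elim ω.1 ω.2]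
        exact le_add_of_nonneg_right (by positivity)
    simp [htails, unifProb, Real.exp_nonneg]
  · have hB := coefBound_pos hdk
    refine (unifProb_not_tailsLE_le hdk (by positivity) (by linarith : 1 ≤ 2 * M) ?_).trans
      (two_mul_exp_neg_two_mul_le hM)
    calc 1024 * (2 * d ^ k * (2 * M))
        = 2 ^ 18 * ((3 * (d : ℝ)) ^ (2 * k) / ε ^ 2) * M * (slack d k ε / 2 / 2) ^ 2 := by
          rw [three_mul_pow_two_mul, slack]
          field_simp
          norm_num
      _ ≤ N * (slack d k ε / 2 / 2) ^ 2 := by gcongr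

theorem unifProb_not_isBalanced_coefBound_le (hε : 0 < ε) (hε1 : ε ≤ 1) (hM : 1 ≤ M)
    (hN : 2 ^ 18 * ((3 * (d : ℝ)) ^ (2 * k) / ε ^ 2) * M ≤ N) :
    unifProb (fun y : Sample N d ↦ ¬ IsBalanced k (1 / (2 * coefBound d k)) y)
      ≤ Real.exp (-M) := by
  have hB := coefBound_nonneg d k
  refine (unifProb_not_isBalanced_le (by positivity)).trans ?_
  rcases Nat.eq_zero_or_pos (d ^ k) with hdk | hdk
  · have hdk' : (d : ℝ) ^ k = 0 := by exact_mod_cast hdk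
    rw [hdk', mul_zero, zero_mul]
    positivity
  have hB := coefBound_pos hdk
  have hD : (1 : ℝ) ≤ (d : ℝ) ^ k := by exact_mod_cast hdk
  have hexponent : 2 * (d : ℝ) ^ k + M ≤ N * (1 / (2 * coefBound d k)) ^ 2 / 2 := by
    calc 2 * (d : ℝ) ^ k + M ≤ 2 ^ 15 * (d : ℝ) ^ k * M := by
          nlinarith [mul_nonneg (sub_nonneg.2 hD) (sub_nonneg.2 hM)]
      _ ≤ 2 ^ 15 * (d : ℝ) ^ k * M / ε ^ 2 :=
          le_div_self (by positivity) (by positivity) (pow_le_one₀ hε.le hε1)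
      _ = 2 ^ 18 * ((3 * (d : ℝ)) ^ (2 * k) / ε ^ 2) * M * (1 / (2 * coefBound d k)) ^ 2 / 2 := by
          rw [three_mul_pow_two_mul]
          field_simp
      _ ≤ N * (1 / (2 * coefBound d k)) ^ 2 / 2 := by gcongr
  calc 2 * (d : ℝ) ^ k * Real.exp (-(N * (1 / (2 * coefBound d k)) ^ 2 / 2))
      ≤ Real.exp (2 * (d : ℝ) ^ k) * Real.exp (-(2 * (d : ℝ) ^ k + M)) := by
        gcongr
        linarith [Real.add_one_le_exp (2 * (d : ℝ) ^ k)]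
    _ = Real.exp (-M) := by rw [← Real.exp_add]; ring_nf

end SampleSize

end OutlierRemoval

open OutlierRemoval

theorem mainTheorem2 :
    ∃ C : ℝ, 1 ≤ C ∧
      ∀ (d N k : ℕ) (ε δ η : ℝ), 0 < ε → ε < 1 → 0 < δ → δ < 1 → 0 < η → η < 1 →
        C * ((3 * (d : ℝ)) ^ (2 * k) / ε ^ 2) * max 1 (Real.log (1 / δ)) ≤ (N : ℝ) →
        (∀ ref inp : OutlierRemoval.Sample N d, OutlierRemoval.AlwaysOutputs k ε ref inp) ∧
        -- `ω.1` is the clean sample and `ω.2` the independent reference sample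
        1 - δ ≤ OutlierRemoval.unifProb
          (fun ω : OutlierRemoval.Sample N d × OutlierRemoval.Sample N d =>
            ∀ (R : Finset (Fin N)) (inp : OutlierRemoval.Sample N d),
              OutlierRemoval.IsContamination η ω.1 R inp →
              ∀ T : Finset (Fin N), OutlierRemoval.IsOutput k ε ω.2 inp T →
                (Rᶜ \ T).card ≤ (R \ T).card) ∧
        1 - δ ≤ OutlierRemoval.unifProb
          (fun ω : OutlierRemoval.Sample N d × OutlierRemoval.Sample N d =>
            ∀ (R : Finset (Fin N)) (inp : OutlierRemoval.Sample N d),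
              OutlierRemoval.IsContamination η ω.1 R inp →
              ∀ T : Finset (Fin N), OutlierRemoval.IsOutput k ε ω.2 inp T →
                ∀ p : OutlierRemoval.CubePoly d, OutlierRemoval.DegLE k p →
                  (∀ x, 0 ≤ OutlierRemoval.evalAt p x) →
                  OutlierRemoval.unifMean p ≤ ε / 8 →
                  ∑ i ∈ T, OutlierRemoval.evalAt p (inp i) ≤ ε * (N : ℝ)) := by
  refine ⟨2 ^ 18, by norm_num, fun d N k ε δ η hε hε1 hδ _ _ _ hN ↦
    ⟨fun ref inp ↦ alwaysOutputs k hε ref inp, one_sub_le_unifProb ?_, one_sub_le_unifProb ?_⟩⟩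
  · refine (unifProb_mono fun ω ↦ mt fun htails ↦ ?_).trans
      ((unifProb_not_tailsLE_slack_le hε (le_max_left _ _) hN).trans (exp_neg_max_le hδ))
    rintro R inp hcont T ⟨i, -, hT, -⟩
    exact hT.card_compl_sdiff_le hε.le htails hcont
  · have hbalanced := (unifProb_not_isBalanced_coefBound_le hε hε1.le (le_max_left _ _) hN).trans
      (exp_neg_max_le hδ)
    rw [← unifProb_snd (Ω' := Sample N d)] at hbalanced
    refine (unifProb_mono fun ω ↦ mt fun href ↦ ?_).trans hbalanced
    intro R inp _ T hT p hp h0 hmean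
    exact href.sum_evalAt_le_of_isOutput hε.le hε1.le hT hp h0 hmean
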